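/- Let $|\psi_1\rangle,|\psi_2\rangle$ be unit vectors in a complex Hilbert space $H$ of arbitrary dimension with $|\langle\psi_1|\psi_2\rangle|=\cos\vartheta\in\,]0,1[$, occurring with a priori probabilities $q_1,q_2>0$, $q_1+q_2=1$, and let $q_{\max}=\max(q_1,q_2)$, $\eta_a=q_1^2+q_2^2$, $\eta_b=2q_1q_2$. A measurement for comparing two such independently drawn states is a POVM $\{F_a,F_b,F_?\}$ on $H\otimes H$ ($F_a$: "equal", $F_b$: "different", $F_?$: inconclusive). It is called *error-free* if $\langle\psi_i\psi_j|F_a|\psi_i\psi_j\rangle=0$ for $i\ne j$ and $\langle\psi_i\psi_i|F_b|\psi_i\psi_i\rangle=0$ for all $i$, and an *unambiguous comparison measurement* if $$q_iq_j\langle\psi_i\psi_j|F_a|\psi_i\psi_j\rangle>0\iff i=j,\qquad q_iq_j\langle\psi_i\psi_j|F_b|\psi_i\psi_j\rangle>0\iff i\neq j .$$ Its rate of success is $P=\sum_{i,j}q_iq_j\langle\psi_i\psi_j|F_a+F_b|\psi_i\psi_j\rangle$. It is *separable* if each of $F_a,F_b,F_?$ is a (finite or weakly convergent countable) sum of operators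 $A\otimes B$ with bounded $A,B\ge0$. Unambiguous discrimination (UD) of $\psi_1,\psi_2$ is a POVM $\{F_1,F_2,F_?\}$ on $H$ with $\langle\psi_2|F_1|\psi_2\rangle=\langle\psi_1|F_2|\psi_1\rangle=0$; it is optimal if it maximizes $q_1\langle\psi_1|F_1|\psi_1\rangle+q_2\langle\psi_2|F_2|\psi_2\rangle$ among all such POVMs. Put $$P_{\rm sep}=\begin{cases}(1-2\sqrt{q_1q_2}\cos\vartheta)^2&\text{if }(\ast\ast)\\ q_{\max}^2\sin^4\vartheta&\text{else,}\end{cases}\qquad(\ast\ast)\ \cos\vartheta<\sqrt{\tfrac{1-q_{\max}}{q_{\max}}},$$ $$P_{\rm opt}=\begin{cases}1-2\sqrt{\eta_a\eta_b}\cos\vartheta&\text{if }(\ast)\\ \frac{1-\cos^2\vartheta}{1+\cos^2\vartheta}\left(1-\frac{\eta_b}{2}\sin^2\vartheta\right)&\text{else,}\end{cases}\qquad(\ast)\ \cos\vartheta<\sqrt{\tfrac{\eta_a}{\eta_b}}\left(1-\sqrt{\tfrac{\eta_a-\eta_b}{\eta_a}}\right).$$ Then: 1. An optimal UD measurement exists.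 For every optimal UD measurement $\{F_1,F_2,F_?\}$, performing it on each subsystem, i.e. $F_a=F_1\otimes F_1+F_2\otimes F_2$ and $F_b=F_1\otimes F_2+F_2\otimes F_1$, is a separable error-free measurement whose rate of success is the square of the success probability of the UD measurement and equals $P_{\rm sep}$; if $(\ast\ast)$ holds, it is moreover an unambiguous comparison measurement. 2. $P_{\rm sep}$ is the maximum of the rate of success over all separable error-free measurements, and the supremum of the rate of success over all separable unambiguous comparison measurements. 3. $P_{\rm opt}$ is the maximum of the rate of success over all (coherent) unambiguous comparison measurements, and $P_{\rm opt}>P_{\rm sep}$ (in particular $P_{\rm opt}\ge P_{\rm sep}$). -/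

import Mathlib

open scoped TensorProduct

noncomputable section

namespace StateComparison

/-- The Hilbert space of the pair of systems: the completed tensor product of `H` with itself. -/
abbrev Pair (H : Type*) [NormedAddCommGroup H] [InnerProductSpace ℂ H] : Type _ :=
  UniformSpace.Completion (H ⊗[ℂ] H)

/-- The product vector `x ⊗ y`. -/
def tvec {H : Type*} [NormedAddCommGroup H] [InnerProductSpace ℂ H] (x y : H) : Pair H :=
  ((x ⊗ₜ[ℂ] y : H ⊗[ℂ] H) : UniformSpace.Completion (H ⊗[ℂ] H))

/-- The product operator `A ⊗ B`, as a bounded operator on the completed tensor product. -/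
def opTensor {H : Type*} [NormedAddCommGroup H] [InnerProductSpace ℂ H]
    (A B : H →L[ℂ] H) : Pair H →L[ℂ] Pair H :=
  (TensorProduct.mapL A B).completion

/-- `tr (F |v⟩⟨v|) = ⟨v, F v⟩`: the probability of the outcome of the POVM element `F` in the pure
state given by the unit vector `v`. -/
def prob {E : Type*} [NormedAddCommGroup E] [InnerProductSpace ℂ E]
    (F : E →L[ℂ] E) (v : E) : ℝ :=
  (inner ℂ v (F v)).re

/-- A POVM with two conclusive outcomes `fst`, `snd` and an inconclusive outcome `inc`. -/
structure POVM (E : Type*) [NormedAddCommGroup E] [InnerProductSpace ℂ E] where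
  fst : E →L[ℂ] E
  snd : E →L[ℂ] E
  inc : E →L[ℂ] E
  fst_pos : fst.IsPositive
  snd_pos : snd.IsPositive
  inc_pos : inc.IsPositive
  sum_eq_one : fst + snd + inc = 1

section Local

variable {H : Type*} [NormedAddCommGroup H] [InnerProductSpace ℂ H]

/-- Unambiguous discrimination of the two pure states `ψ 0`, `ψ 1` on a single system: the outcome
`fst` never occurs for `ψ 1` and the outcome `snd` never occurs for `ψ 0`. -/
def IsUD (ψ : Fin 2 → H) (M : POVM H) : Prop :=
  prob M.fst (ψ 1) = 0 ∧ prob M.snd (ψ 0) = 0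

/-- Success probability of discrimination. -/
def udRate (ψ : Fin 2 → H) (q : Fin 2 → ℝ) (M : POVM H) : ℝ :=
  q 0 * prob M.fst (ψ 0) + q 1 * prob M.snd (ψ 1)

/-- Optimal unambiguous discrimination. -/
def IsOptimalUD (ψ : Fin 2 → H) (q : Fin 2 → ℝ) (M : POVM H) : Prop :=
  IsUD ψ M ∧ ∀ M' : POVM H, IsUD ψ M' → udRate ψ q M' ≤ udRate ψ q M

end Local

section Comparison

variable {H : Type*} [NormedAddCommGroup H] [InnerProductSpace ℂ H]

/-- A comparison measurement is a POVM on the pair, `fst` being the answer "equal" (`F_a`) and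
`snd` the answer "different" (`F_b`). It makes no errors if `F_a` never occurs for two different
states and `F_b` never for two equal states. -/
def IsErrorFree (ψ : Fin 2 → H) (N : POVM (Pair H)) : Prop :=
  (∀ i j, i ≠ j → prob N.fst (tvec (ψ i) (ψ j)) = 0) ∧
    ∀ i, prob N.snd (tvec (ψ i) (ψ i)) = 0

/-- Unambiguous state comparison: on the total state `ψ i ⊗ ψ j`, which is prepared with probability
`q i * q j`, the answer "equal" occurs with positive probability iff the states are equal, and the
answer "different" occurs with positive probability iff the states are different. -/
def IsComparison (ψ : Fin 2 → H) (q : Fin 2 → ℝ) (N : POVM (Pair H)) : Prop :=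
  (∀ i j, 0 < q i * q j * prob N.fst (tvec (ψ i) (ψ j)) ↔ i = j) ∧
    ∀ i j, 0 < q i * q j * prob N.snd (tvec (ψ i) (ψ j)) ↔ i ≠ j

/-- Rate of success of a comparison measurement. -/
def rate (ψ : Fin 2 → H) (q : Fin 2 → ℝ) (N : POVM (Pair H)) : ℝ :=
  ∑ i, ∑ j, q i * q j * prob (N.fst + N.snd) (tvec (ψ i) (ψ j))

/-- Separable operators: sums of products `A ⊗ B` of positive operators. Finite sums are included
(pad with zeros); a countable sum is meant in the weak operator topology. -/
def IsSeparableOp (F : Pair H →L[ℂ] Pair H) : Prop :=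
  ∃ A B : ℕ → (H →L[ℂ] H), (∀ n, (A n).IsPositive) ∧ (∀ n, (B n).IsPositive) ∧
    ∀ u v : Pair H, HasSum (fun n => inner ℂ u (opTensor (A n) (B n) v)) (inner ℂ u (F v))

/-- A separable POVM: every element is separable. -/
def IsSeparable (N : POVM (Pair H)) : Prop :=
  IsSeparableOp N.fst ∧ IsSeparableOp N.snd ∧ IsSeparableOp N.inc

/-- `N` consists in performing the discrimination measurement `M` on each of the two systems and
comparing the two outcomes. -/
def IsLocalDiscrimination (M : POVM H) (N : POVM (Pair H)) : Prop :=
  N.fst = opTensor M.fst M.fst + opTensor M.snd M.snd ∧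
    N.snd = opTensor M.fst M.snd + opTensor M.snd M.fst

end Comparison

/-- The condition under which both outcomes of the optimal local discrimination are used. -/
def SepCondition (q : Fin 2 → ℝ) (θ : ℝ) : Prop :=
  Real.cos θ < √((1 - max (q 0) (q 1)) / max (q 0) (q 1))

open Classical in
/-- The rate of success `P_sep`. -/
def Psep (q : Fin 2 → ℝ) (θ : ℝ) : ℝ :=
  if SepCondition q θ then (1 - 2 * √(q 0 * q 1) * Real.cos θ) ^ 2
  else max (q 0) (q 1) ^ 2 * Real.sin θ ^ 4

/-- `η_a`, the probability that the two states are equal. -/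
def etaA (q : Fin 2 → ℝ) : ℝ := q 0 ^ 2 + q 1 ^ 2

/-- `η_b`, the probability that the two states are different. -/
def etaB (q : Fin 2 → ℝ) : ℝ := 2 * q 0 * q 1

/-- The condition distinguishing the two regimes of the optimal coherent measurement. -/
def OptCondition (q : Fin 2 → ℝ) (θ : ℝ) : Prop :=
  Real.cos θ < √(etaA q / etaB q) * (1 - √((etaA q - etaB q) / etaA q))

open Classical in
/-- The rate of success `P_opt`. -/
def Popt (q : Fin 2 → ℝ) (θ : ℝ) : ℝ :=
  if OptCondition q θ then 1 - 2 * √(etaA q * etaB q) * Real.cos θ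
  else (1 - Real.cos θ ^ 2) / (1 + Real.cos θ ^ 2) * (1 - etaB q / 2 * Real.sin θ ^ 2)

end StateComparison

end

/-!
After a choice of phases the two states have a real overlap `c`. Every rate in the theorem comes
from one problem: the unambiguous discrimination of two pure states with overlap `κ` and weights `w₀`,
`w₁`. Its detection probabilities `(p, r)` are exactly constrained by `(1 - p) (1 - r) ≥ κ²`
(`exists_povm_discrimination`, with rank-one operators along the two reciprocal vectors), and its
optimal value `discriminationRate w₀ w₁ κ` has a dual certificate (`exists_dual`): coefficients
`x`, `y` with `w₀ ≤ x²`, `w₁ ≤ y²` and `x² + y² + 2 κ x y` equal to that value.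

*Local discrimination.* If `F₁` annihilates `ψ₁` and `F₂` annihilates `ψ₀`, the expectation of
`F₁ + F₂ ≤ 1` in `x ψ₀ + y ψ₁` is `x² p + y² r`, so the certificate bounds the rate. Performing
the measurement on both systems squares it (`IsUD.rate_eq`).

*Separable measurements.* Absence of errors forces every product term of `F_a` and `F_b` to
annihilate one of the states in one of the factors, and this kills the remaining transition amplitudes
between the four product states (`IsSeparableOp.inner_eq_zero`). The expectation of `F_a + F_b` in
the square `(x ψ₀ + y ψ₁) ⊗ (x ψ₀ + y ψ₁)` is therefore again a weighted sum of detection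
probabilities, and the square of the local certificate bounds the rate
(`IsErrorFree.rate_le_of_isSeparable`). The bound is approached by unambiguous comparison
measurements, because optimal pairs `(p, r)` are limits of pairs with positive entries
(`IsFeasible.mix`).

*Coherent measurements.* `ψ₀ψ₀ - ψ₁ψ₁` and `ψ₀ψ₁ - ψ₁ψ₀` are orthogonal to each other and to the
span of `ψ₀ψ₀ + ψ₁ψ₁` and `ψ₀ψ₁ + ψ₁ψ₀`. They can be detected with certainty, which leaves the
discrimination of the last two vectors, whose overlap is `2 c / (1 + c²)`
(`exists_isComparison`). Conversely, the expectations of `F_a + F_b` in the vectors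
`x ψᵢψᵢ + (y / 2) (ψ₀ψ₁ + ψ₁ψ₀)`, averaged with the weights `qᵢ²`, bound the rate
(`IsErrorFree.rate_le`). That the coherent optimum is strictly larger is an inequality between the
separable optimum and the rate of one explicit coherent measurement
(`exists_isFeasible_discriminationRate_sq_lt`).
-/

namespace StateComparison

open Filter Topology
open scoped ComplexOrder

/-! ### Expectations and rank-one measurements -/

section Operators

variable {E : Type*} [NormedAddCommGroup E] [InnerProductSpace ℂ E]

lemma prob_nonneg {F : E →L[ℂ] E} (hF : F.IsPositive) (v : E) : 0 ≤ prob F v :=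
  hF.re_inner_nonneg_right v

lemma prob_add_left (F G : E →L[ℂ] E) (v : E) : prob (F + G) v = prob F v + prob G v := by
  simp [prob]

lemma prob_smul (F : E →L[ℂ] E) (z : ℂ) (v : E) : prob F (z • v) = ‖z‖ ^ 2 * prob F v := by
  have h : inner ℂ (z • v) (F (z • v)) = ((‖z‖ ^ 2 : ℝ) : ℂ) * inner ℂ v (F v) := by
    rw [map_smul, inner_smul_left, inner_smul_right, ← mul_assoc, Complex.conj_mul']
    push_cast; rfl
  rw [prob, h, Complex.re_ofReal_mul, prob]

/-- A vector in which a positive operator has expectation zero lies in its kernel. -/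
lemma apply_eq_zero_of_prob_eq_zero [CompleteSpace E] {F : E →L[ℂ] E} (hF : F.IsPositive)
    {v : E} (hv : prob F v = 0) : F v = 0 := by
  have hF0 : 0 ≤ F := F.nonneg_iff_isPositive.mpr hF
  obtain ⟨S, hS, hSF⟩ : ∃ S : E →L[ℂ] E, S.IsPositive ∧ S * S = F :=
    ⟨CFC.sqrt F, (ContinuousLinearMap.nonneg_iff_isPositive _).mp (CFC.sqrt_nonneg F),
      CFC.sqrt_mul_sqrt_self F hF0⟩
  subst hSF
  have h1 : inner ℂ v ((S * S) v) = inner ℂ (S v) (S v) :=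
    (hS.inner_left_eq_inner_right v (S v)).symm
  have h2 : S v = 0 := by
    rw [prob, h1] at hv
    exact inner_self_eq_zero.mp (Complex.ext (by simpa using hv)
      (by simpa using inner_self_im (𝕜 := ℂ) (S v)))
  simp [h2]

lemma POVM.prob_fst_add_prob_snd_le (M : POVM E) (v : E) :
    prob M.fst v + prob M.snd v ≤ ‖v‖ ^ 2 := by
  have h := congrArg (fun F => prob F v) M.sum_eq_one
  simp only [prob_add_left] at h
  have h1 : prob (1 : E →L[ℂ] E) v = ‖v‖ ^ 2 := by
    simpa [prob] using inner_self_eq_norm_sq (𝕜 := ℂ) v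
  linarith [prob_nonneg M.inc_pos v]

lemma POVM.prob_snd_le (M : POVM E) (v : E) : prob M.snd v ≤ ‖v‖ ^ 2 := by
  linarith [M.prob_fst_add_prob_snd_le v, prob_nonneg M.fst_pos v]

/-- Vectors in the kernel of a symmetric operator do not affect its expectation. -/
lemma prob_add_of_apply_eq_zero {F : E →L[ℂ] E} (hF : F.IsPositive) (v : E) {w : E}
    (hw : F w = 0) : prob F (v + w) = prob F v := by
  have h : inner ℂ w (F v) = 0 := by rw [← hF.inner_left_eq_inner_right, hw, inner_zero_left]
  simp [prob, hw, h]

/-- Expectation in a sum of two vectors between which the operator has no transition amplitude. -/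
lemma prob_add_of_inner_eq_zero {F : E →L[ℂ] E} (hF : F.IsPositive) {v w : E}
    (h : inner ℂ v (F w) = 0) : prob F (v + w) = prob F v + prob F w := by
  have h' : inner ℂ w (F v) = 0 := by
    rw [← hF.inner_left_eq_inner_right, ← inner_conj_symm, h, map_zero]
  simp [prob, h, h']

lemma prob_rankOne (x v : E) :
    prob (InnerProductSpace.rankOne ℂ x x) v = ‖(inner ℂ x v : ℂ)‖ ^ 2 := by
  rw [prob, InnerProductSpace.inner_right_rankOne_apply, ← inner_conj_symm v x, Complex.conj_mul']
  norm_cast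

lemma prob_real_smul_rankOne (r : ℝ) (x v : E) :
    prob ((r : ℂ) • InnerProductSpace.rankOne ℂ x x) v = r * ‖(inner ℂ x v : ℂ)‖ ^ 2 := by
  rw [← prob_rankOne]
  simp [prob]

/-- The measurement with the outcomes `X |s⟩⟨s| + |w⟩⟨w|` and `B |f⟩⟨f| + |a⟩⟨a|`. -/
lemma exists_povm_rankOne (s f w a : E) {X B : ℝ} (hX : 0 ≤ X) (hB : 0 ≤ B)
    (h : ∀ v : E, X * ‖(inner ℂ s v : ℂ)‖ ^ 2 + B * ‖(inner ℂ f v : ℂ)‖ ^ 2 +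
      ‖(inner ℂ w v : ℂ)‖ ^ 2 + ‖(inner ℂ a v : ℂ)‖ ^ 2 ≤ ‖v‖ ^ 2) :
    ∃ M : POVM E, ∀ v,
      prob M.fst v = X * ‖(inner ℂ s v : ℂ)‖ ^ 2 + ‖(inner ℂ w v : ℂ)‖ ^ 2 ∧
      prob M.snd v = B * ‖(inner ℂ f v : ℂ)‖ ^ 2 + ‖(inner ℂ a v : ℂ)‖ ^ 2 := by
  have hpos : ∀ x : E, (InnerProductSpace.rankOne ℂ x x).IsPositive := fun x =>
    InnerProductSpace.isPositive_rankOne_self x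
  have hc : ∀ {r : ℝ}, 0 ≤ r → (0 : ℂ) ≤ r := fun hr => Complex.zero_le_real.mpr hr
  set F := (X : ℂ) • InnerProductSpace.rankOne ℂ s s + InnerProductSpace.rankOne ℂ w w with hF
  set G := (B : ℂ) • InnerProductSpace.rankOne ℂ f f + InnerProductSpace.rankOne ℂ a a with hG
  have hFp : F.IsPositive := ((hpos s).smul_of_nonneg (hc hX)).add (hpos w)
  have hGp : G.IsPositive := ((hpos f).smul_of_nonneg (hc hB)).add (hpos a)
  have hFv : ∀ v, prob F v = X * ‖(inner ℂ s v : ℂ)‖ ^ 2 + ‖(inner ℂ w v : ℂ)‖ ^ 2 := fun v => by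
    rw [hF, prob_add_left, prob_real_smul_rankOne, prob_rankOne]
  have hGv : ∀ v, prob G v = B * ‖(inner ℂ f v : ℂ)‖ ^ 2 + ‖(inner ℂ a v : ℂ)‖ ^ 2 := fun v => by
    rw [hG, prob_add_left, prob_real_smul_rankOne, prob_rankOne]
  refine ⟨⟨F, G, 1 - F - G, hFp, hGp, ?_, by abel⟩, fun v => ⟨hFv v, hGv v⟩⟩
  refine ⟨?_, fun v => ?_⟩
  · exact (ContinuousLinearMap.isPositive_one.isSymmetric.sub hFp.isSymmetric).sub hGp.isSymmetric
  · have h1 : prob (1 - F - G) v = ‖v‖ ^ 2 - prob F v - prob G v := by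
      have := inner_self_eq_norm_sq (𝕜 := ℂ) v
      simp only [prob, sub_apply, inner_sub_right, Complex.sub_re,
        one_apply_eq_self]
      rw [← this]; rfl
    have h2 := h v
    have h3 : 0 ≤ prob (1 - F - G) v := by rw [h1, hFv, hGv]; linarith
    rw [ContinuousLinearMap.reApplyInnerSelf_apply, inner_re_symm]
    exact h3

/-- Two weighted rank-one operators with sum at most `1`: the condition is that the weighted Gram
matrix of the two vectors has all its eigenvalues at most `1`. -/
lemma weighted_rankOne_le {s f : E} {X B m g : ℝ} (hX : 0 ≤ X) (hB : 0 ≤ B)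
    (hs : ‖s‖ ^ 2 = m) (hf : ‖f‖ ^ 2 = m) (hsf : ‖(inner ℂ s f : ℂ)‖ = g)
    (hXm : X * m ≤ 1) (hBm : B * m ≤ 1) (hdet : X * B * g ^ 2 ≤ (1 - X * m) * (1 - B * m))
    (v : E) :
    X * ‖(inner ℂ s v : ℂ)‖ ^ 2 + B * ‖(inner ℂ f v : ℂ)‖ ^ 2 ≤ ‖v‖ ^ 2 := by
  set P : ℂ := inner ℂ s v with hP
  set R : ℂ := inner ℂ f v with hR
  set Q := X * ‖P‖ ^ 2 + B * ‖R‖ ^ 2 with hQ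
  have hQ0 : 0 ≤ Q := by positivity
  -- `u` is the image of `v` under the operator in question, whose expectation in `v` is `Q`;
  -- it suffices to show `‖u‖² ≤ Q`.
  set u : E := ((X : ℂ) * P) • s + ((B : ℂ) * R) • f with hu
  have huv : inner ℂ u v = (Q : ℂ) := by
    rw [hu, inner_add_left, inner_smul_left, inner_smul_left, ← hP, ← hR, hQ]
    simp only [map_mul, Complex.conj_ofReal]
    rw [mul_assoc, mul_assoc, Complex.conj_mul', Complex.conj_mul']
    push_cast; ring
  have hg : 0 ≤ g := hsf ▸ norm_nonneg _
  have hu2 : ‖u‖ ^ 2 ≤ Q := by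
    have h1 : ‖u‖ ^ 2 ≤
        X ^ 2 * m * ‖P‖ ^ 2 + B ^ 2 * m * ‖R‖ ^ 2 + 2 * (X * B * g * ‖P‖ * ‖R‖) := by
      rw [hu, @norm_add_sq ℂ, norm_smul, norm_smul, mul_pow, mul_pow, hs, hf]
      have h2 : RCLike.re (inner ℂ (((X : ℂ) * P) • s) (((B : ℂ) * R) • f) : ℂ) ≤
          X * B * g * ‖P‖ * ‖R‖ := by
        refine (RCLike.re_le_norm _).trans (le_of_eq ?_)
        rw [inner_smul_left, inner_smul_right, norm_mul, norm_mul, hsf]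
        simp [abs_of_nonneg hX, abs_of_nonneg hB]; ring
      have h3 : ‖(X : ℂ) * P‖ = X * ‖P‖ := by simp [abs_of_nonneg hX]
      have h4 : ‖(B : ℂ) * R‖ = B * ‖R‖ := by simp [abs_of_nonneg hB]
      rw [h3, h4]
      linarith
    set t := X * (1 - X * m) with ht
    set r := B * (1 - B * m) with hr
    have ht0 : 0 ≤ t := mul_nonneg hX (by linarith)
    have hr0 : 0 ≤ r := mul_nonneg hB (by linarith)
    have htr : (X * B * g) ^ 2 ≤ t * r := by
      have := mul_le_mul_of_nonneg_left hdet (mul_nonneg hX hB)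
      calc (X * B * g) ^ 2 = X * B * (X * B * g ^ 2) := by ring
        _ ≤ _ := this
        _ = t * r := by rw [ht, hr]; ring
    have h5 : 2 * (X * B * g * ‖P‖ * ‖R‖) ≤ t * ‖P‖ ^ 2 + r * ‖R‖ ^ 2 := by
      refine (sq_le_sq₀ (by positivity) (by positivity)).mp ?_
      have h6 := mul_le_mul_of_nonneg_right htr (by positivity : 0 ≤ 4 * (‖P‖ ^ 2 * ‖R‖ ^ 2))
      have h7 := sq_nonneg (t * ‖P‖ ^ 2 - r * ‖R‖ ^ 2)
      nlinarith [h6, h7]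
    rw [ht, hr] at h5
    rw [hQ]
    nlinarith [h1, h5]
  have hQv : Q ≤ ‖u‖ * ‖v‖ := by
    have := norm_inner_le_norm (𝕜 := ℂ) u v
    rwa [huv, Complex.norm_real, Real.norm_of_nonneg hQ0] at this
  rcases hQ0.eq_or_lt with h0 | h0
  · rw [← h0]; positivity
  · have h8 : Q * Q ≤ Q * ‖v‖ ^ 2 := by
      calc Q * Q ≤ (‖u‖ * ‖v‖) * (‖u‖ * ‖v‖) := mul_self_le_mul_self hQ0 hQv
        _ = ‖u‖ ^ 2 * ‖v‖ ^ 2 := by ring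
        _ ≤ _ := mul_le_mul_of_nonneg_right hu2 (by positivity)
    exact le_of_mul_le_mul_left h8 h0

/-- Removing the component along `w` leaves a vector whose square norm is smaller by at least
`|⟨w, v⟩|²`, if `‖w‖ ≤ 1`. -/
lemma norm_sub_smul_sq_le {w : E} (hw : ‖w‖ ≤ 1) (v : E) :
    ‖v - (inner ℂ w v : ℂ) • w‖ ^ 2 ≤ ‖v‖ ^ 2 - ‖(inner ℂ w v : ℂ)‖ ^ 2 := by
  rw [@norm_sub_sq ℂ, inner_smul_right, ← inner_conj_symm v w, Complex.mul_conj', norm_smul]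
  have h1 : RCLike.re ((‖(inner ℂ w v : ℂ)‖ : ℂ) ^ 2) = ‖(inner ℂ w v : ℂ)‖ ^ 2 := by
    norm_cast
  rw [h1, mul_pow]
  have h2 : ‖w‖ ^ 2 ≤ 1 := pow_le_one₀ (norm_nonneg _) hw
  nlinarith [mul_le_mul_of_nonneg_left h2 (sq_nonneg ‖(inner ℂ w v : ℂ)‖)]

/-- Discrimination of two unit vectors `u₀`, `u₁` with real overlap `κ`, extended by two orthogonal
directions: every pair `(p, r)` with `(1 - p) (1 - r) ≥ κ²` is a pair of detection
probabilities. -/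
lemma exists_povm_discrimination {u₀ u₁ w a : E} {κ p r : ℝ} (hu₀ : ‖u₀‖ = 1) (hu₁ : ‖u₁‖ = 1)
    (hκ : inner ℂ u₀ u₁ = (κ : ℂ)) (hκ0 : 0 < κ) (hκ1 : κ < 1) (hp0 : 0 ≤ p) (hp1 : p ≤ 1)
    (hr0 : 0 ≤ r) (hr1 : r ≤ 1) (hpr : κ ^ 2 ≤ (1 - p) * (1 - r))
    (hw : ‖w‖ ≤ 1) (ha : ‖a‖ ≤ 1) (h0w : inner ℂ u₀ w = (0 : ℂ)) (h1w : inner ℂ u₁ w = (0 : ℂ))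
    (h0a : inner ℂ u₀ a = (0 : ℂ)) (h1a : inner ℂ u₁ a = (0 : ℂ)) (haw : inner ℂ a w = (0 : ℂ)) :
    ∃ M : POVM E, ∀ x₀ x₁ y z : ℂ,
      prob M.fst (x₀ • u₀ + x₁ • u₁ + y • w + z • a) =
        p * ‖x₀‖ ^ 2 + ‖y‖ ^ 2 * ‖w‖ ^ 4 ∧
      prob M.snd (x₀ • u₀ + x₁ • u₁ + y • w + z • a) =
        r * ‖x₁‖ ^ 2 + ‖z‖ ^ 2 * ‖a‖ ^ 4 := by
  have hm : 0 < 1 - κ ^ 2 := by nlinarith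
  have h10 : inner ℂ u₁ u₀ = (κ : ℂ) := by rw [← inner_conj_symm, hκ, Complex.conj_ofReal]
  -- The reciprocal vectors: `s` is orthogonal to `u₁`, and `f` to `u₀`.
  set s : E := u₀ - (κ : ℂ) • u₁ with hs
  set f : E := u₁ - (κ : ℂ) • u₀ with hf
  have hs0 : inner ℂ s u₀ = ((1 - κ ^ 2 : ℝ) : ℂ) := by
    simp [hs, hu₀, h10]; ring
  have hs1 : inner ℂ s u₁ = (0 : ℂ) := by
    simp [hs, hu₁, hκ]
  have hf0 : inner ℂ f u₀ = (0 : ℂ) := by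
    simp [hf, hu₀, h10]
  have hf1 : inner ℂ f u₁ = ((1 - κ ^ 2 : ℝ) : ℂ) := by
    simp [hf, hu₁, hκ]; ring
  have hsw : inner ℂ s w = (0 : ℂ) := by simp [hs, h0w, h1w]
  have hfw : inner ℂ f w = (0 : ℂ) := by simp [hf, h0w, h1w]
  have hsa : inner ℂ s a = (0 : ℂ) := by simp [hs, h0a, h1a]
  have hfa : inner ℂ f a = (0 : ℂ) := by simp [hf, h0a, h1a]
  have hsn : ‖s‖ ^ 2 = 1 - κ ^ 2 := by
    have : (inner ℂ s s : ℂ) = ((1 - κ ^ 2 : ℝ) : ℂ) := by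
      conv_lhs => rw [hs]
      rw [inner_sub_right, inner_smul_right, ← hs, hs0, hs1]; simp
    rw [← inner_self_eq_norm_sq (𝕜 := ℂ), this]
    exact Complex.ofReal_re _
  have hfn : ‖f‖ ^ 2 = 1 - κ ^ 2 := by
    have : (inner ℂ f f : ℂ) = ((1 - κ ^ 2 : ℝ) : ℂ) := by
      conv_lhs => rw [hf]
      rw [inner_sub_right, inner_smul_right, ← hf, hf0, hf1]; simp
    rw [← inner_self_eq_norm_sq (𝕜 := ℂ), this]
    exact Complex.ofReal_re _
  have hsf : ‖(inner ℂ s f : ℂ)‖ = κ * (1 - κ ^ 2) := by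
    have : (inner ℂ s f : ℂ) = ((-(κ * (1 - κ ^ 2)) : ℝ) : ℂ) := by
      rw [hf, inner_sub_right, inner_smul_right, hs0, hs1]; push_cast; ring
    rw [this, Complex.norm_real, norm_neg, Real.norm_of_nonneg (by positivity)]
  set m := 1 - κ ^ 2 with hmdef
  have hpm : p ≤ m := by nlinarith
  have hrm : r ≤ m := by nlinarith
  have key := weighted_rankOne_le (X := p / m ^ 2) (B := r / m ^ 2) (by positivity)
    (by positivity) hsn hfn hsf
    (by rw [div_mul_eq_mul_div, div_le_one (by positivity)]; nlinarith)
    (by rw [div_mul_eq_mul_div, div_le_one (by positivity)]; nlinarith)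
    (by
      have e1 : p / m ^ 2 * (r / m ^ 2) * (κ * m) ^ 2 = p * r * κ ^ 2 / m ^ 2 := by
        field_simp
      have e2 : (1 - p / m ^ 2 * m) * (1 - r / m ^ 2 * m) = (m - p) * (m - r) / m ^ 2 := by
        field_simp
      rw [e1, e2]
      refine div_le_div_of_nonneg_right ?_ (by positivity)
      have e3 : κ ^ 2 = 1 - m := by rw [hmdef]; ring
      rw [e3] at hpr ⊢
      nlinarith [mul_nonneg hm.le (sub_nonneg.mpr hpr)])
  have hwa : inner ℂ w a = (0 : ℂ) := by rw [← inner_conj_symm, haw, map_zero]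
  have hw0 : inner ℂ w u₀ = (0 : ℂ) := by rw [← inner_conj_symm, h0w, map_zero]
  have hw1 : inner ℂ w u₁ = (0 : ℂ) := by rw [← inner_conj_symm, h1w, map_zero]
  have ha0 : inner ℂ a u₀ = (0 : ℂ) := by rw [← inner_conj_symm, h0a, map_zero]
  have ha1 : inner ℂ a u₁ = (0 : ℂ) := by rw [← inner_conj_symm, h1a, map_zero]
  obtain ⟨M, hM⟩ := exists_povm_rankOne s f w a (X := p / m ^ 2) (B := r / m ^ 2)
    (by positivity) (by positivity) (fun v => by
      set v₁ := v - (inner ℂ w v : ℂ) • w with hv₁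
      set v₂ := v₁ - (inner ℂ a v₁ : ℂ) • a with hv₂
      have k1 := norm_sub_smul_sq_le hw v
      have k2 := norm_sub_smul_sq_le ha v₁
      have k3 := key v₂
      have e1 : (inner ℂ a v₁ : ℂ) = inner ℂ a v := by
        simp [hv₁, haw]
      have e2 : (inner ℂ s v₂ : ℂ) = inner ℂ s v := by
        simp [hv₁, hv₂, hsa, hsw]
      have e3 : (inner ℂ f v₂ : ℂ) = inner ℂ f v := by
        simp [hv₁, hv₂, hfa, hfw]
      rw [e2, e3] at k3
      rw [← hv₁] at k1
      rw [← hv₂, e1] at k2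
      linarith)
  refine ⟨M, fun x₀ x₁ y z => ?_⟩
  have hww : (inner ℂ w w : ℂ) = ((‖w‖ ^ 2 : ℝ) : ℂ) := by simp [inner_self_eq_norm_sq_to_K]
  have haa : (inner ℂ a a : ℂ) = ((‖a‖ ^ 2 : ℝ) : ℂ) := by simp [inner_self_eq_norm_sq_to_K]
  have nm : ‖((m : ℝ) : ℂ)‖ = m := by rw [Complex.norm_real, Real.norm_of_nonneg hm.le]
  have nw : ‖((‖w‖ ^ 2 : ℝ) : ℂ)‖ = ‖w‖ ^ 2 := by
    rw [Complex.norm_real, Real.norm_of_nonneg (by positivity)]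
  have na : ‖((‖a‖ ^ 2 : ℝ) : ℂ)‖ = ‖a‖ ^ 2 := by
    rw [Complex.norm_real, Real.norm_of_nonneg (by positivity)]
  constructor
  · rw [(hM _).1]
    simp only [inner_add_right, inner_smul_right, hs0, hs1, hsw, hsa, hw0, hw1, hww, hwa,
      mul_zero, add_zero, zero_add, norm_mul, nm, nw]
    field_simp
  · rw [(hM _).2]
    simp only [inner_add_right, inner_smul_right, hf0, hf1, hfw, hfa, ha0, ha1, haa, haw,
      mul_zero, add_zero, zero_add, norm_mul, nm, na]
    field_simp

end Operators

/-! ### Product operators on the pair -/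

section Tensor

variable {H : Type*} [NormedAddCommGroup H] [InnerProductSpace ℂ H]

lemma inner_tvec (a b c d : H) :
    inner ℂ (tvec a b) (tvec c d) = (inner ℂ a c * inner ℂ b d : ℂ) := by
  rw [tvec, tvec, UniformSpace.Completion.inner_coe, TensorProduct.inner_tmul]

lemma norm_tvec (a b : H) : ‖tvec a b‖ = ‖a‖ * ‖b‖ := by
  rw [tvec, UniformSpace.Completion.norm_coe, TensorProduct.norm_tmul]

lemma tvec_add_left (a b c : H) : tvec (a + b) c = tvec a c + tvec b c := by
  simp only [tvec, TensorProduct.add_tmul, UniformSpace.Completion.coe_add]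

lemma tvec_add_right (a b c : H) : tvec a (b + c) = tvec a b + tvec a c := by
  simp only [tvec, TensorProduct.tmul_add, UniformSpace.Completion.coe_add]

lemma tvec_smul_left (z : ℂ) (a b : H) : tvec (z • a) b = z • tvec a b := by
  rw [tvec, tvec, ← TensorProduct.smul_tmul', UniformSpace.Completion.coe_smul]

lemma tvec_smul_right (z : ℂ) (a b : H) : tvec a (z • b) = z • tvec a b := by
  simp only [tvec, TensorProduct.tmul_smul, UniformSpace.Completion.coe_smul]

lemma opTensor_coe (A B : H →L[ℂ] H) (x : H ⊗[ℂ] H) :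
    opTensor A B (x : Pair H) = ((TensorProduct.mapL A B x : H ⊗[ℂ] H) : Pair H) :=
  ContinuousLinearMap.completion_apply_coe _ _

lemma opTensor_tvec (A B : H →L[ℂ] H) (x y : H) :
    opTensor A B (tvec x y) = tvec (A x) (B y) := by
  rw [tvec, opTensor_coe, TensorProduct.mapL_tmul, tvec]

/-- Bounded operators on the pair agree if they agree on the algebraic tensor product. -/
lemma pair_op_ext {F G : Pair H →L[ℂ] Pair H}
    (h : ∀ x : H ⊗[ℂ] H, F (x : Pair H) = G (x : Pair H)) : F = G := by
  ext v
  induction v using UniformSpace.Completion.induction_on with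
  | hp => exact isClosed_eq F.continuous G.continuous
  | ih x => exact h x

lemma opTensor_add_left (A A' B : H →L[ℂ] H) :
    opTensor (A + A') B = opTensor A B + opTensor A' B :=
  pair_op_ext fun x => by
    simp only [add_apply, opTensor_coe, TensorProduct.mapL_add_left,
      UniformSpace.Completion.coe_add]

lemma opTensor_add_right (A B B' : H →L[ℂ] H) :
    opTensor A (B + B') = opTensor A B + opTensor A B' :=
  pair_op_ext fun x => by
    simp only [add_apply, opTensor_coe, TensorProduct.mapL_add_right,
      UniformSpace.Completion.coe_add]

lemma opTensor_zero_left (B : H →L[ℂ] H) : opTensor 0 B = 0 :=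
  pair_op_ext fun x => by
    simp [opTensor_coe]

lemma opTensor_one : opTensor (1 : H →L[ℂ] H) 1 = 1 :=
  pair_op_ext fun x => by
    rw [opTensor_coe, show (1 : H →L[ℂ] H) = .id ℂ H from rfl, TensorProduct.mapL_id_id]
    rfl

lemma opTensor_mul (A A' B B' : H →L[ℂ] H) :
    opTensor (A * A') (B * B') = opTensor A B * opTensor A' B' :=
  pair_op_ext fun x => by
    rw [mul_apply_eq_comp, opTensor_coe, opTensor_coe, opTensor_coe,
      TensorProduct.mapL_mul]
    rfl

lemma opTensor_isSymmetric {A B : H →L[ℂ] H} (hA : A.IsSymmetric) (hB : B.IsSymmetric) :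
    (opTensor A B).IsSymmetric := by
  have key : ∀ x y : H ⊗[ℂ] H, inner ℂ (TensorProduct.mapL A B x) y =
      (inner ℂ x (TensorProduct.mapL A B y) : ℂ) := by
    intro x y
    induction x with
    | zero => simp
    | add x₁ x₂ h₁ h₂ => rw [map_add, inner_add_left, inner_add_left, h₁, h₂]
    | tmul a b =>
      induction y with
      | zero => simp
      | add y₁ y₂ h₁ h₂ => rw [map_add, inner_add_right, inner_add_right, h₁, h₂]
      | tmul c d =>
        simp only [TensorProduct.mapL_tmul, TensorProduct.inner_tmul]
        rw [show inner ℂ (A a) c = (inner ℂ a (A c) : ℂ) from hA a c,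
          show inner ℂ (B b) d = (inner ℂ b (B d) : ℂ) from hB b d]
  intro u v
  change inner ℂ (opTensor A B u) v = (inner ℂ u (opTensor A B v) : ℂ)
  induction u, v using UniformSpace.Completion.induction_on₂ with
  | hp =>
    exact isClosed_eq (by fun_prop) (by fun_prop)
  | ih x y =>
    rw [opTensor_coe, opTensor_coe, UniformSpace.Completion.inner_coe,
      UniformSpace.Completion.inner_coe, key]

/-- Products of positive operators are positive: `A ⊗ B` is the square of the symmetric operator
`√A ⊗ √B`. -/
lemma opTensor_isPositive [CompleteSpace H] {A B : H →L[ℂ] H} (hA : A.IsPositive)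
    (hB : B.IsPositive) : (opTensor A B).IsPositive := by
  have hsqrt : ∀ {F : H →L[ℂ] H}, F.IsPositive → ∃ S : H →L[ℂ] H, S.IsSymmetric ∧ S * S = F :=
    fun {F} hF => ⟨CFC.sqrt F,
      ((ContinuousLinearMap.nonneg_iff_isPositive _).mp (CFC.sqrt_nonneg F)).isSymmetric,
      CFC.sqrt_mul_sqrt_self F (F.nonneg_iff_isPositive.mpr hF)⟩
  obtain ⟨S, hS, rfl⟩ := hsqrt hA
  obtain ⟨T, hT, rfl⟩ := hsqrt hB
  have hST := opTensor_isSymmetric hS hT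
  refine ⟨opTensor_isSymmetric hA.isSymmetric hB.isSymmetric, fun v => ?_⟩
  rw [ContinuousLinearMap.reApplyInnerSelf_apply, opTensor_mul]
  have h : inner ℂ (opTensor S T (opTensor S T v)) v =
      (inner ℂ (opTensor S T v) (opTensor S T v) : ℂ) := hST _ _
  rw [mul_apply_eq_comp, h]
  exact inner_self_nonneg

/-- The transition amplitudes of a product operator between product vectors factorize. -/
lemma inner_opTensor_tvec (A B : H →L[ℂ] H) (a b c d : H) :
    inner ℂ (tvec a b) (opTensor A B (tvec c d)) = (inner ℂ a (A c) * inner ℂ b (B d) : ℂ) := by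
  rw [opTensor_tvec, inner_tvec]

lemma inner_apply_self_eq_prob {E : Type*} [NormedAddCommGroup E] [InnerProductSpace ℂ E]
    {F : E →L[ℂ] E} (hF : F.IsPositive) (v : E) : inner ℂ v (F v) = (prob F v : ℂ) := by
  refine Complex.ext (by simp [prob]) ?_
  have := hF.inner_nonneg_right v
  rw [Complex.le_def] at this
  simpa using this.2.symm

lemma prob_opTensor_tvec {A B : H →L[ℂ] H} (hA : A.IsPositive) (hB : B.IsPositive) (x y : H) :
    prob (opTensor A B) (tvec x y) = prob A x * prob B y := by
  rw [prob, inner_opTensor_tvec, inner_apply_self_eq_prob hA, inner_apply_self_eq_prob hB,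
    ← Complex.ofReal_mul, Complex.ofReal_re]

lemma isSeparableOp_opTensor {A B : H →L[ℂ] H} (hA : A.IsPositive) (hB : B.IsPositive) :
    IsSeparableOp (opTensor A B) := by
  refine ⟨fun n => if n = 0 then A else 0, fun n => if n = 0 then B else 0, fun n => ?_,
    fun n => ?_, fun u v => ?_⟩
  · dsimp only; split_ifs
    exacts [hA, ContinuousLinearMap.isPositive_zero]
  · dsimp only; split_ifs
    exacts [hB, ContinuousLinearMap.isPositive_zero]
  · refine hasSum_single 0 fun n hn => ?_
    simp [hn, opTensor_zero_left]

/-- The two sums are merged by placing their terms at the even and at the odd indices. -/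
lemma IsSeparableOp.add {F G : Pair H →L[ℂ] Pair H} (hF : IsSeparableOp F)
    (hG : IsSeparableOp G) : IsSeparableOp (F + G) := by
  obtain ⟨A, B, hA, hB, hAB⟩ := hF
  obtain ⟨A', B', hA', hB', hAB'⟩ := hG
  refine ⟨fun n => if Even n then A (n / 2) else A' (n / 2),
    fun n => if Even n then B (n / 2) else B' (n / 2), fun n => ?_, fun n => ?_, fun u v => ?_⟩
  · dsimp only; split_ifs
    exacts [hA _, hA' _]
  · dsimp only; split_ifs
    exacts [hB _, hB' _]
  · rw [add_apply, inner_add_right]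
    refine HasSum.even_add_odd ?_ ?_
    · simpa using hAB u v
    · have h : ∀ k : ℕ, (2 * k + 1) / 2 = k := fun k => by omega
      simpa [h] using hAB' u v

end Tensor

/-! ### Measurements composed of local ones, and separable operators -/

section LocalDiscrimination

variable {H : Type*} [NormedAddCommGroup H] [InnerProductSpace ℂ H]

/-- Performing a measurement on each of the two systems and comparing the conclusive outcomes is a
separable measurement. -/
lemma exists_isLocalDiscrimination [CompleteSpace H] (M : POVM H) :
    ∃ N : POVM (Pair H), IsLocalDiscrimination M N ∧ IsSeparable N := by
  have h1 := M.fst_pos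
  have h2 := M.snd_pos
  have h3 := M.inc_pos
  have hs : opTensor M.fst M.fst + opTensor M.snd M.snd +
      (opTensor M.fst M.snd + opTensor M.snd M.fst) +
      (opTensor M.inc (M.fst + M.snd + M.inc) + opTensor (M.fst + M.snd) M.inc) = 1 := by
    have h := opTensor_one (H := H)
    rw [← M.sum_eq_one] at h
    rw [← h]
    simp only [opTensor_add_left, opTensor_add_right]
    abel
  refine ⟨⟨opTensor M.fst M.fst + opTensor M.snd M.snd,
    opTensor M.fst M.snd + opTensor M.snd M.fst,
    opTensor M.inc (M.fst + M.snd + M.inc) + opTensor (M.fst + M.snd) M.inc,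
    (opTensor_isPositive h1 h1).add (opTensor_isPositive h2 h2),
    (opTensor_isPositive h1 h2).add (opTensor_isPositive h2 h1),
    (opTensor_isPositive h3 ((h1.add h2).add h3)).add (opTensor_isPositive (h1.add h2) h3), hs⟩,
    ⟨rfl, rfl⟩, ?_, ?_, ?_⟩
  · exact (isSeparableOp_opTensor h1 h1).add (isSeparableOp_opTensor h2 h2)
  · exact (isSeparableOp_opTensor h1 h2).add (isSeparableOp_opTensor h2 h1)
  · exact (isSeparableOp_opTensor h3 ((h1.add h2).add h3)).add
      (isSeparableOp_opTensor (h1.add h2) h3)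

lemma IsLocalDiscrimination.prob_fst {M : POVM H} {N : POVM (Pair H)}
    (h : IsLocalDiscrimination M N) (x y : H) :
    prob N.fst (tvec x y) = prob M.fst x * prob M.fst y + prob M.snd x * prob M.snd y := by
  rw [h.1, prob_add_left, prob_opTensor_tvec M.fst_pos M.fst_pos,
    prob_opTensor_tvec M.snd_pos M.snd_pos]

lemma IsLocalDiscrimination.prob_snd {M : POVM H} {N : POVM (Pair H)}
    (h : IsLocalDiscrimination M N) (x y : H) :
    prob N.snd (tvec x y) = prob M.fst x * prob M.snd y + prob M.snd x * prob M.fst y := by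
  rw [h.2, prob_add_left, prob_opTensor_tvec M.fst_pos M.snd_pos,
    prob_opTensor_tvec M.snd_pos M.fst_pos]

variable {ψ : Fin 2 → H} {q : Fin 2 → ℝ}

lemma IsUD.isErrorFree {M : POVM H} {N : POVM (Pair H)} (hM : IsUD ψ M)
    (h : IsLocalDiscrimination M N) : IsErrorFree ψ N := by
  refine ⟨fun i j hij => ?_, fun i => ?_⟩
  · rw [h.prob_fst]
    fin_cases i <;> fin_cases j <;> simp_all [hM.1, hM.2]
  · rw [h.prob_snd]
    fin_cases i <;> simp [hM.1, hM.2]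

lemma IsUD.isComparison (hq : ∀ i, 0 < q i) {M : POVM H} {N : POVM (Pair H)} (hM : IsUD ψ M)
    (h : IsLocalDiscrimination M N) (h0 : 0 < prob M.fst (ψ 0)) (h1 : 0 < prob M.snd (ψ 1)) :
    IsComparison ψ q N := by
  have hq0 := hq 0
  have hq1 := hq 1
  refine ⟨fun i j => ?_, fun i j => ?_⟩
  · rw [h.prob_fst]
    fin_cases i <;> fin_cases j <;> simp [hM.1, hM.2] <;> positivity
  · rw [h.prob_snd]
    fin_cases i <;> fin_cases j <;> simp [hM.1, hM.2] <;> positivity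

lemma IsUD.rate_eq {M : POVM H} {N : POVM (Pair H)} (hM : IsUD ψ M)
    (h : IsLocalDiscrimination M N) : rate ψ q N = udRate ψ q M ^ 2 := by
  simp only [rate, udRate, prob_add_left, h.prob_fst, h.prob_snd, Fin.sum_univ_two, hM.1, hM.2]
  ring

/-- An unambiguous comparison measurement makes no errors. -/
lemma IsComparison.isErrorFree (hq : ∀ i, 0 < q i) {N : POVM (Pair H)}
    (h : IsComparison ψ q N) : IsErrorFree ψ N := by
  refine ⟨fun i j hij => ?_, fun i => ?_⟩
  · refine le_antisymm (not_lt.mp fun hp => hij ((h.1 i j).mp ?_)) (prob_nonneg N.fst_pos _)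
    exact mul_pos (mul_pos (hq i) (hq j)) hp
  · refine le_antisymm (not_lt.mp fun hp => (h.2 i i).mp ?_ rfl) (prob_nonneg N.snd_pos _)
    exact mul_pos (mul_pos (hq i) (hq i)) hp

/-- If the expectation of a separable operator in `a ⊗ d` vanishes, then every term `A ⊗ B` has
`A a = 0` or `B d = 0`. Either alternative suffices for the amplitude between `a ⊗ b` and `c ⊗ d`
to vanish, although neither of these vectors is `a ⊗ d`. -/
lemma IsSeparableOp.inner_eq_zero [CompleteSpace H] {F : Pair H →L[ℂ] Pair H}
    (hF : IsSeparableOp F) {a b c d : H} (h : prob F (tvec a d) = 0) :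
    inner ℂ (tvec a b) (F (tvec c d)) = (0 : ℂ) := by
  obtain ⟨A, B, hA, hB, hAB⟩ := hF
  have h0 : ∀ n, prob (A n) a * prob (B n) d = 0 := by
    have hs := Complex.hasSum_re (hAB (tvec a d) (tvec a d))
    change HasSum (fun n => prob (opTensor (A n) (B n)) (tvec a d)) (prob F (tvec a d)) at hs
    simp only [prob_opTensor_tvec (hA _) (hB _), h] at hs
    have := (hasSum_zero_iff_of_nonneg fun n =>
      mul_nonneg (prob_nonneg (hA n) a) (prob_nonneg (hB n) d)).mp hs
    exact fun n => congrFun this n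
  refine (hAB _ _).unique ?_
  convert hasSum_zero with n
  rw [inner_opTensor_tvec]
  rcases mul_eq_zero.mp (h0 n) with h1 | h1
  · rw [← (hA n).inner_left_eq_inner_right, apply_eq_zero_of_prob_eq_zero (hA n) h1,
      inner_zero_left, zero_mul]
  · rw [apply_eq_zero_of_prob_eq_zero (hB n) h1, inner_zero_right, mul_zero]

end LocalDiscrimination

/-! ### The optimal value of discrimination -/

section Scalar

open Classical in
/-- The maximal rate of success of the unambiguous discrimination of two pure states with overlap
`κ` that occur with the (not necessarily normalized) weights `w₀` and `w₁`. -/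
noncomputable def discriminationRate (w₀ w₁ κ : ℝ) : ℝ :=
  if κ < √(min w₀ w₁ / max w₀ w₁) then w₀ + w₁ - 2 * √(w₀ * w₁) * κ
  else max w₀ w₁ * (1 - κ ^ 2)

lemma discriminationRate_comm (w₀ w₁ κ : ℝ) :
    discriminationRate w₀ w₁ κ = discriminationRate w₁ w₀ κ := by
  simp only [discriminationRate, min_comm w₀, max_comm w₀, mul_comm w₀, add_comm w₀]

lemma sqrt_div_eq {w₀ w₁ : ℝ} (h₀ : 0 < w₀) : √(w₁ / w₀) = √w₁ / √w₀ :=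
  Real.sqrt_div' _ h₀.le

variable {w₀ w₁ κ : ℝ}

/-- A vector of coefficients that certifies the upper bound `discriminationRate` for the
discrimination of two states, the first of which is the more probable one. -/
lemma exists_dual_of_le (h₁ : 0 < w₁) (h : w₁ ≤ w₀) (hκ : 0 < κ) :
    ∃ x y : ℝ, x ^ 2 = w₀ ∧ w₁ ≤ y ^ 2 ∧
      x ^ 2 + y ^ 2 + 2 * κ * x * y = discriminationRate w₀ w₁ κ := by
  have h₀ : 0 < w₀ := h₁.trans_le h
  have s₀ := Real.sq_sqrt h₀.le
  have s₁ := Real.sq_sqrt h₁.le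
  rw [discriminationRate, min_eq_right h, max_eq_left h]
  split_ifs with hc
  · refine ⟨√w₀, -√w₁, s₀, by rw [neg_sq, s₁], ?_⟩
    rw [Real.sqrt_mul h₀.le, neg_sq, s₀, s₁]; ring
  · refine ⟨√w₀, -(κ * √w₀), s₀, ?_, ?_⟩
    · rw [not_lt, Real.sqrt_le_left hκ.le, div_le_iff₀ h₀] at hc
      rw [neg_sq, mul_pow, s₀]; exact hc
    · rw [neg_sq, mul_pow, s₀]
      linear_combination (-2 * κ ^ 2) * s₀

lemma exists_dual (h₀ : 0 < w₀) (h₁ : 0 < w₁) (hκ : 0 < κ) :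
    ∃ x y : ℝ, w₀ ≤ x ^ 2 ∧ w₁ ≤ y ^ 2 ∧
      x ^ 2 + y ^ 2 + 2 * κ * x * y = discriminationRate w₀ w₁ κ := by
  rcases le_total w₁ w₀ with h | h
  · obtain ⟨x, y, hx, hy, hxy⟩ := exists_dual_of_le h₁ h hκ
    exact ⟨x, y, hx.ge, hy, hxy⟩
  · obtain ⟨x, y, hx, hy, hxy⟩ := exists_dual_of_le h₀ h hκ
    exact ⟨y, x, hy, hx.ge, by rw [discriminationRate_comm, ← hxy]; ring⟩

/-- The pairs of detection probabilities that measurements can attain on two pure states with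
overlap `κ`. -/
def IsFeasible (κ p r : ℝ) : Prop :=
  0 ≤ p ∧ p ≤ 1 ∧ 0 ≤ r ∧ r ≤ 1 ∧ κ ^ 2 ≤ (1 - p) * (1 - r)

lemma IsFeasible.symm {p r : ℝ} (h : IsFeasible κ p r) : IsFeasible κ r p :=
  ⟨h.2.2.1, h.2.2.2.1, h.1, h.2.1, by rw [mul_comm]; exact h.2.2.2.2⟩

lemma exists_isFeasible_of_le (h₁ : 0 < w₁) (h : w₁ ≤ w₀) (hκ : 0 < κ) (hκ1 : κ < 1) :
    ∃ p r, IsFeasible κ p r ∧ w₀ * p + w₁ * r = discriminationRate w₀ w₁ κ := by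
  have h₀ : 0 < w₀ := h₁.trans_le h
  have s₀ := Real.sq_sqrt h₀.le
  have s₁ := Real.sq_sqrt h₁.le
  have p₀ := Real.sqrt_pos.mpr h₀
  have p₁ := Real.sqrt_pos.mpr h₁
  rw [discriminationRate, min_eq_right h, max_eq_left h]
  split_ifs with hc
  -- The stationary point of `w₀ p + w₁ r` on the hyperbola `(1 - p) (1 - r) = κ²`.
  · have hle : √w₁ ≤ √w₀ := Real.sqrt_le_sqrt h
    rw [sqrt_div_eq h₀, lt_div_iff₀ p₀] at hc
    refine ⟨1 - √w₁ / √w₀ * κ, 1 - √w₀ / √w₁ * κ, ⟨?_, ?_, ?_, ?_, ?_⟩, ?_⟩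
    · have : √w₁ / √w₀ ≤ 1 := (div_le_one p₀).mpr hle
      nlinarith
    · have : 0 ≤ √w₁ / √w₀ * κ := by positivity
      linarith
    · have : √w₀ / √w₁ * κ ≤ 1 := by
        rw [div_mul_eq_mul_div, div_le_one p₁]; linarith
      linarith
    · have : 0 ≤ √w₀ / √w₁ * κ := by positivity
      linarith
    · refine le_of_eq ?_
      field_simp
      ring
    · rw [Real.sqrt_mul h₀.le]
      have e₀ : w₀ * (√w₁ / √w₀) = √w₀ * √w₁ := by
        rw [← mul_div_assoc, div_eq_iff p₀.ne']; linear_combination (-√w₁) * s₀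
      have e₁ : w₁ * (√w₀ / √w₁) = √w₀ * √w₁ := by
        rw [← mul_div_assoc, div_eq_iff p₁.ne']; linear_combination (-√w₀) * s₁
      linear_combination (-κ) * e₀ - κ * e₁
  -- The hyperbola's stationary point does not have `r > 0`; the maximum is at the boundary `r = 0`.
  · exact ⟨1 - κ ^ 2, 0, ⟨by nlinarith, by nlinarith, le_rfl, zero_le_one, by linarith⟩, by ring⟩

lemma exists_isFeasible (h₀ : 0 < w₀) (h₁ : 0 < w₁) (hκ : 0 < κ) (hκ1 : κ < 1) :
    ∃ p r, IsFeasible κ p r ∧ w₀ * p + w₁ * r = discriminationRate w₀ w₁ κ := by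
  rcases le_total w₁ w₀ with h | h
  · exact exists_isFeasible_of_le h₁ h hκ hκ1
  · obtain ⟨p, r, hpr, he⟩ := exists_isFeasible_of_le h₀ h hκ hκ1
    exact ⟨r, p, hpr.symm, by rw [discriminationRate_comm, ← he]; ring⟩

/-- A feasible pair can be moved towards `(1 - κ, 1 - κ)`, which makes both probabilities
positive. -/
lemma IsFeasible.mix {p r t : ℝ} (h : IsFeasible κ p r) (hκ : 0 < κ) (hκ1 : κ < 1) (ht0 : 0 ≤ t)
    (ht1 : t ≤ 1) : IsFeasible κ ((1 - t) * p + t * (1 - κ)) ((1 - t) * r + t * (1 - κ)) := by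
  obtain ⟨hp0, hp1, hr0, hr1, hpr⟩ := h
  have ht : 0 ≤ 1 - t := by linarith
  have hκ' : 0 ≤ 1 - κ := by linarith
  have hX : 2 * κ ≤ (1 - p) + (1 - r) := by
    refine (sq_le_sq₀ (by linarith) (by linarith)).mp ?_
    nlinarith [sq_nonneg (p - r)]
  refine ⟨by positivity, by nlinarith, by positivity, by nlinarith, ?_⟩
  nlinarith [mul_le_mul_of_nonneg_left hpr (mul_nonneg ht ht),
    mul_le_mul_of_nonneg_left hX (mul_nonneg (mul_nonneg ht ht0) hκ.le)]

/-- In the regime in which both outcomes are used, giving up one of them lowers the rate. -/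
lemma max_mul_lt_discriminationRate (h₀ : 0 < w₀) (h₁ : 0 < w₁)
    (hκ : κ < √(min w₀ w₁ / max w₀ w₁)) :
    max w₀ w₁ * (1 - κ ^ 2) < discriminationRate w₀ w₁ κ := by
  rw [discriminationRate, if_pos hκ]
  wlog h : w₁ ≤ w₀ generalizing w₀ w₁
  · have := this h₁ h₀ (by rwa [min_comm, max_comm]) (le_of_not_ge h)
    rw [max_comm, mul_comm w₀]; linarith
  rw [min_eq_right h, max_eq_left h, sqrt_div_eq h₀, lt_div_iff₀ (Real.sqrt_pos.mpr h₀)] at hκ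
  rw [max_eq_left h, Real.sqrt_mul h₀.le]
  have s₀ := Real.sq_sqrt h₀.le
  have s₁ := Real.sq_sqrt h₁.le
  have : 0 < (√w₁ - κ * √w₀) ^ 2 := by
    have : 0 < √w₁ - κ * √w₀ := by linarith
    positivity
  nlinarith

end Scalar

/-! ### The rates of success in terms of the optimal value of discrimination -/

section Rates

variable {q : Fin 2 → ℝ} {θ : ℝ}

lemma sepCondition_iff (hq : q 0 + q 1 = 1) :
    SepCondition q θ ↔ Real.cos θ < √(min (q 0) (q 1) / max (q 0) (q 1)) := by
  have : 1 - max (q 0) (q 1) = min (q 0) (q 1) := by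
    linarith [min_add_max (q 0) (q 1)]
  rw [SepCondition, this]

lemma psep_eq (hq : q 0 + q 1 = 1) :
    Psep q θ = discriminationRate (q 0) (q 1) (Real.cos θ) ^ 2 := by
  have hs : Real.sin θ ^ 4 = (1 - Real.cos θ ^ 2) ^ 2 := by
    rw [← Real.sin_sq]; ring
  rw [Psep, discriminationRate]
  simp only [sepCondition_iff hq]
  split_ifs
  · rw [hq]
  · rw [hs]; ring

lemma etaA_pos (h₀ : 0 < q 0) : 0 < etaA q := by unfold etaA; positivity

lemma etaB_pos (h₀ : 0 < q 0) (h₁ : 0 < q 1) : 0 < etaB q := by unfold etaB; positivity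

lemma etaB_le_etaA (q : Fin 2 → ℝ) : etaB q ≤ etaA q := by
  unfold etaA etaB; nlinarith [sq_nonneg (q 0 - q 1)]

lemma etaA_add_etaB (hq : q 0 + q 1 = 1) : etaA q + etaB q = 1 := by
  unfold etaA etaB; linear_combination (q 0 + q 1 + 1) * hq

/-- The overlap of the normalized vectors `ψ₀ψ₀ + ψ₁ψ₁` and `ψ₀ψ₁ + ψ₁ψ₀`, if `c` is the overlap
of `ψ₀` and `ψ₁`. -/
noncomputable def pairOverlap (c : ℝ) : ℝ := 2 * c / (1 + c ^ 2)

lemma pairOverlap_pos {c : ℝ} (hc : 0 < c) : 0 < pairOverlap c := by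
  unfold pairOverlap; positivity

lemma pairOverlap_lt_one {c : ℝ} (hc : c < 1) : pairOverlap c < 1 := by
  unfold pairOverlap
  rw [div_lt_one (by positivity)]
  nlinarith [mul_pos (sub_pos.mpr hc) (sub_pos.mpr hc)]

lemma one_add_sq_mul_pairOverlap (c : ℝ) : (1 + c ^ 2) * pairOverlap c = 2 * c := by
  unfold pairOverlap; field_simp

lemma optCondition_iff (h₀ : 0 < q 0) (h₁ : 0 < q 1) (hc : Real.cos θ < 1) :
    OptCondition q θ ↔ pairOverlap (Real.cos θ) < √(etaB q / etaA q) := by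
  have ha := etaA_pos h₀
  have hb := etaB_pos h₀ h₁
  have hab := etaB_le_etaA q
  set c := Real.cos θ with hcdef
  set R := √(etaA q / etaB q) with hR
  have hR2 : R ^ 2 = etaA q / etaB q := Real.sq_sqrt (by positivity)
  have hR1 : 1 ≤ R := by
    rw [hR, Real.one_le_sqrt, one_le_div hb]; exact hab
  have e1 : √(etaB q / etaA q) = 1 / R := by
    rw [hR, one_div, ← Real.sqrt_inv, inv_div]
  have e2 : R * √((etaA q - etaB q) / etaA q) = √(R ^ 2 - 1) := by
    rw [hR, ← Real.sqrt_mul (by positivity), ← hR, hR2]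
    congr 1
    field_simp
  have e3 : R * (1 - √((etaA q - etaB q) / etaA q)) = R - √(R ^ 2 - 1) := by
    rw [mul_sub, mul_one, e2]
  rw [OptCondition, ← hcdef, ← hR, e3, e1, pairOverlap, div_lt_div_iff₀ (by positivity)
    (by positivity), lt_sub_comm, Real.sqrt_lt' (by linarith)]
  constructor <;> intro h <;> nlinarith

lemma popt_eq (h₀ : 0 < q 0) (h₁ : 0 < q 1) (hq : q 0 + q 1 = 1) (hc : Real.cos θ < 1) :
    Popt q θ = (1 - Real.cos θ ^ 2 + (1 + Real.cos θ ^ 2) *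
      discriminationRate (etaA q) (etaB q) (pairOverlap (Real.cos θ))) / 2 := by
  have hab := etaB_le_etaA q
  have hsum := etaA_add_etaB hq
  rw [Popt, discriminationRate, min_eq_right hab, max_eq_left hab]
  simp only [optCondition_iff h₀ h₁ hc]
  have hκ := one_add_sq_mul_pairOverlap (Real.cos θ)
  split_ifs
  · rw [hsum]
    linear_combination √(etaA q * etaB q) * hκ
  · rw [Real.sin_sq, pairOverlap]
    have : etaA q = 1 - etaB q := by linarith
    rw [this]
    field_simp
    ring

end Rates

/-! ### Independence of phases -/

section Phases

variable {H : Type*} [NormedAddCommGroup H] [InnerProductSpace ℂ H]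
variable {ψ : Fin 2 → H} {q : Fin 2 → ℝ} {ω : Fin 2 → ℂ}

lemma prob_phase (hω : ∀ i, ‖ω i‖ = 1) (F : H →L[ℂ] H) (i : Fin 2) :
    prob F (ω i • ψ i) = prob F (ψ i) := by
  rw [prob_smul, hω, one_pow, one_mul]

lemma prob_tvec_phase (hω : ∀ i, ‖ω i‖ = 1) (F : Pair H →L[ℂ] Pair H) (i j : Fin 2) :
    prob F (tvec (ω i • ψ i) (ω j • ψ j)) = prob F (tvec (ψ i) (ψ j)) := by
  rw [tvec_smul_left, tvec_smul_right, prob_smul, prob_smul, hω, hω]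
  norm_num

lemma isUD_phase (hω : ∀ i, ‖ω i‖ = 1) : IsUD (fun i => ω i • ψ i) = IsUD ψ := by
  funext M
  simp only [IsUD, prob_phase hω]

lemma udRate_phase (hω : ∀ i, ‖ω i‖ = 1) : udRate (fun i => ω i • ψ i) q = udRate ψ q := by
  funext M
  simp only [udRate, prob_phase hω]

lemma isOptimalUD_phase (hω : ∀ i, ‖ω i‖ = 1) :
    IsOptimalUD (fun i => ω i • ψ i) q = IsOptimalUD ψ q := by
  funext M
  simp only [IsOptimalUD, isUD_phase hω, udRate_phase hω]

lemma isErrorFree_phase (hω : ∀ i, ‖ω i‖ = 1) :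
    IsErrorFree (fun i => ω i • ψ i) = IsErrorFree ψ := by
  funext N
  simp only [IsErrorFree, prob_tvec_phase hω]

lemma isComparison_phase (hω : ∀ i, ‖ω i‖ = 1) :
    IsComparison (fun i => ω i • ψ i) q = IsComparison ψ q := by
  funext N
  simp only [IsComparison, prob_tvec_phase hω]

lemma rate_phase (hω : ∀ i, ‖ω i‖ = 1) : rate (fun i => ω i • ψ i) q = rate ψ q := by
  funext N
  simp only [rate, prob_tvec_phase hω]

/-- The phases of two vectors can be chosen such that their inner product is nonnegative. -/
lemma exists_phases (ψ : Fin 2 → H) :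
    ∃ ω : Fin 2 → ℂ, (∀ i, ‖ω i‖ = 1) ∧
      inner ℂ (ω 0 • ψ 0) (ω 1 • ψ 1) = (‖(inner ℂ (ψ 0) (ψ 1) : ℂ)‖ : ℂ) := by
  obtain ⟨z, hz, h⟩ := Complex.exists_norm_eq_mul_self (inner ℂ (ψ 0) (ψ 1) : ℂ)
  refine ⟨![1, z], fun i => by fin_cases i <;> simp [hz], ?_⟩
  simp [h]

end Phases

/-! ### Local discrimination -/

section Real

variable {H : Type*} [NormedAddCommGroup H] [InnerProductSpace ℂ H]
variable {ψ : Fin 2 → H} {q : Fin 2 → ℝ} {c : ℝ}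

lemma inner_symm_real (hc : inner ℂ (ψ 0) (ψ 1) = (c : ℂ)) :
    inner ℂ (ψ 1) (ψ 0) = (c : ℂ) := by
  rw [← inner_conj_symm, hc, Complex.conj_ofReal]

lemma inner_self_of_norm_eq_one {x : H} (hx : ‖x‖ = 1) : inner ℂ x x = (1 : ℂ) := by
  simp [hx]

/-- Norms in the real span of two vectors, from their Gram matrix. -/
lemma norm_sq_real_combination {E : Type*} [NormedAddCommGroup E] [InnerProductSpace ℂ E]
    {u v : E} {a b g : ℝ} (hu : ‖u‖ ^ 2 = a) (hv : ‖v‖ ^ 2 = b) (huv : inner ℂ u v = (g : ℂ))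
    (x y : ℝ) : ‖(x : ℂ) • u + (y : ℂ) • v‖ ^ 2 = x ^ 2 * a + y ^ 2 * b + 2 * g * x * y := by
  rw [@norm_add_sq ℂ, inner_smul_left, inner_smul_right, huv, norm_smul, norm_smul, mul_pow,
    mul_pow, hu, hv]
  have : RCLike.re ((starRingEnd ℂ) (x : ℂ) * ((y : ℂ) * (g : ℂ))) = x * (y * g) := by
    rw [Complex.conj_ofReal, ← Complex.ofReal_mul, ← Complex.ofReal_mul]
    exact Complex.ofReal_re _
  rw [this]
  simp only [Complex.norm_real, Real.norm_eq_abs, sq_abs]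
  ring

lemma norm_sq_combination (hψ : ∀ i, ‖ψ i‖ = 1) (hc : inner ℂ (ψ 0) (ψ 1) = (c : ℂ)) (x y : ℝ) :
    ‖(x : ℂ) • ψ 0 + (y : ℂ) • ψ 1‖ ^ 2 = x ^ 2 + y ^ 2 + 2 * c * x * y := by
  rw [norm_sq_real_combination (a := 1) (b := 1) (by simp [hψ]) (by simp [hψ]) hc]
  ring

lemma prob_real_smul {E : Type*} [NormedAddCommGroup E] [InnerProductSpace ℂ E] (F : E →L[ℂ] E)
    (x : ℝ) (v : E) : prob F ((x : ℂ) • v) = x ^ 2 * prob F v := by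
  rw [prob_smul, Complex.norm_real, Real.norm_eq_abs, sq_abs]

/-- The trade-off between the two detection probabilities: conclusive outcomes of unambiguous
discrimination occur incoherently on every superposition of the two states. -/
lemma IsUD.prob_le [CompleteSpace H] (hψ : ∀ i, ‖ψ i‖ = 1)
    (hc : inner ℂ (ψ 0) (ψ 1) = (c : ℂ)) {M : POVM H} (hM : IsUD ψ M) (x y : ℝ) :
    x ^ 2 * prob M.fst (ψ 0) + y ^ 2 * prob M.snd (ψ 1) ≤ x ^ 2 + y ^ 2 + 2 * c * x * y := by
  have h := M.prob_fst_add_prob_snd_le ((x : ℂ) • ψ 0 + (y : ℂ) • ψ 1)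
  rw [norm_sq_combination hψ hc, prob_add_of_apply_eq_zero M.fst_pos _ (by
    rw [map_smul, apply_eq_zero_of_prob_eq_zero M.fst_pos hM.1, smul_zero]),
    add_comm (((x : ℂ) • ψ 0)), prob_add_of_apply_eq_zero M.snd_pos _ (by
    rw [map_smul, apply_eq_zero_of_prob_eq_zero M.snd_pos hM.2, smul_zero]),
    prob_real_smul, prob_real_smul] at h
  exact h

lemma IsUD.udRate_le [CompleteSpace H] (hψ : ∀ i, ‖ψ i‖ = 1)
    (hc : inner ℂ (ψ 0) (ψ 1) = (c : ℂ)) (hc0 : 0 < c) (hq : ∀ i, 0 < q i)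
    {M : POVM H} (hM : IsUD ψ M) : udRate ψ q M ≤ discriminationRate (q 0) (q 1) c := by
  obtain ⟨x, y, hx, hy, hxy⟩ := exists_dual (hq 0) (hq 1) hc0
  rw [← hxy]
  refine le_trans ?_ (hM.prob_le hψ hc x y)
  exact add_le_add (mul_le_mul_of_nonneg_right hx (prob_nonneg M.fst_pos _))
    (mul_le_mul_of_nonneg_right hy (prob_nonneg M.snd_pos _))

lemma exists_isUD (hψ : ∀ i, ‖ψ i‖ = 1) (hc : inner ℂ (ψ 0) (ψ 1) = (c : ℂ)) (hc0 : 0 < c)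
    (hc1 : c < 1) {p r : ℝ} (h : IsFeasible c p r) :
    ∃ M : POVM H, IsUD ψ M ∧ prob M.fst (ψ 0) = p ∧ prob M.snd (ψ 1) = r := by
  obtain ⟨hp0, hp1, hr0, hr1, hpr⟩ := h
  obtain ⟨M, hM⟩ := exists_povm_discrimination (w := 0) (a := 0) (hψ 0) (hψ 1) hc hc0 hc1 hp0 hp1
    hr0 hr1 hpr (by simp) (by simp) (by simp) (by simp) (by simp) (by simp) (by simp)
  have h0 := hM 1 0 0 0
  have h1 := hM 0 1 0 0
  simp only [one_smul, zero_smul, add_zero, zero_add, norm_one, norm_zero] at h0 h1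
  norm_num at h0 h1
  exact ⟨M, ⟨h1.1, h0.2⟩, h0.1, h1.2⟩

lemma IsOptimalUD.udRate_eq [CompleteSpace H] (hψ : ∀ i, ‖ψ i‖ = 1)
    (hc : inner ℂ (ψ 0) (ψ 1) = (c : ℂ)) (hc0 : 0 < c) (hc1 : c < 1) (hq : ∀ i, 0 < q i)
    {M : POVM H} (hM : IsOptimalUD ψ q M) :
    udRate ψ q M = discriminationRate (q 0) (q 1) c := by
  obtain ⟨p, r, hpr, he⟩ := exists_isFeasible (hq 0) (hq 1) hc0 hc1
  obtain ⟨M', hM', h0, h1⟩ := exists_isUD hψ hc hc0 hc1 hpr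
  refine le_antisymm (hM.1.udRate_le hψ hc hc0 hq) ?_
  have := hM.2 M' hM'
  rwa [udRate, h0, h1, he] at this

lemma exists_isOptimalUD [CompleteSpace H] (hψ : ∀ i, ‖ψ i‖ = 1)
    (hc : inner ℂ (ψ 0) (ψ 1) = (c : ℂ)) (hc0 : 0 < c) (hc1 : c < 1) (hq : ∀ i, 0 < q i) :
    ∃ M : POVM H, IsOptimalUD ψ q M := by
  obtain ⟨p, r, hpr, he⟩ := exists_isFeasible (hq 0) (hq 1) hc0 hc1
  obtain ⟨M, hM, h0, h1⟩ := exists_isUD hψ hc hc0 hc1 hpr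
  refine ⟨M, hM, fun M' hM' => ?_⟩
  rw [show udRate ψ q M = _ by rw [udRate, h0, h1, he]]
  exact hM'.udRate_le hψ hc hc0 hq

/-- In the regime in which it pays to use both conclusive outcomes, every optimal discrimination
measurement does so. -/
lemma IsOptimalUD.prob_pos [CompleteSpace H] (hψ : ∀ i, ‖ψ i‖ = 1)
    (hc : inner ℂ (ψ 0) (ψ 1) = (c : ℂ)) (hc0 : 0 < c) (hc1 : c < 1) (hq : ∀ i, 0 < q i)
    (hcond : c < √(min (q 0) (q 1) / max (q 0) (q 1))) {M : POVM H} (hM : IsOptimalUD ψ q M) :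
    0 < prob M.fst (ψ 0) ∧ 0 < prob M.snd (ψ 1) := by
  have hr := hM.udRate_eq hψ hc hc0 hc1 hq
  have hlt := max_mul_lt_discriminationRate (hq 0) (hq 1) hcond
  rw [← hr, udRate] at hlt
  have h0 := hM.1.prob_le hψ hc 1 (-c)
  have h1 := hM.1.prob_le hψ hc (-c) 1
  have hp0 := prob_nonneg M.fst_pos (ψ 0)
  have hp1 := prob_nonneg M.snd_pos (ψ 1)
  have hc2 : 0 ≤ 1 - c ^ 2 := by nlinarith
  have hm0 := mul_le_mul_of_nonneg_right (le_max_left (q 0) (q 1)) hc2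
  have hm1 := mul_le_mul_of_nonneg_right (le_max_right (q 0) (q 1)) hc2
  constructor
  · refine lt_of_le_of_ne hp0 fun h => ?_
    rw [← h] at hlt h1
    have : prob M.snd (ψ 1) ≤ 1 - c ^ 2 := by linarith
    nlinarith [mul_le_mul_of_nonneg_left this (hq 1).le]
  · refine lt_of_le_of_ne hp1 fun h => ?_
    rw [← h] at hlt h0
    have : prob M.fst (ψ 0) ≤ 1 - c ^ 2 := by linarith
    nlinarith [mul_le_mul_of_nonneg_left this (hq 0).le]

end Real

/-! ### The bound for separable measurements -/

section Comparison

variable {H : Type*} [NormedAddCommGroup H] [InnerProductSpace ℂ H]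
variable {ψ : Fin 2 → H} {q : Fin 2 → ℝ} {c : ℝ}

lemma IsErrorFree.rate_eq {N : POVM (Pair H)} (h : IsErrorFree ψ N) :
    rate ψ q N =
      q 0 ^ 2 * prob N.fst (tvec (ψ 0) (ψ 0)) + q 1 ^ 2 * prob N.fst (tvec (ψ 1) (ψ 1)) +
      q 0 * q 1 * (prob N.snd (tvec (ψ 0) (ψ 1)) + prob N.snd (tvec (ψ 1) (ψ 0))) := by
  simp only [rate, Fin.sum_univ_two, prob_add_left, h.2, h.1 0 1 (by decide),
    h.1 1 0 (by decide)]
  ring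

lemma tvec_combination (x y : ℂ) (a b : H) :
    tvec (x • a + y • b) (x • a + y • b) =
      ((x ^ 2) • tvec a a + (y ^ 2) • tvec b b) +
      ((x * y) • tvec a b + (x * y) • tvec b a) := by
  simp only [tvec_add_left, tvec_add_right, tvec_smul_left, tvec_smul_right]
  module

/-- The conclusive outcomes of a separable measurement without errors have no transition amplitudes
between the four product states, so that on the product of two equal superpositions they occur
incoherently. -/
lemma IsErrorFree.prob_le_of_isSeparable [CompleteSpace H] (hψ : ∀ i, ‖ψ i‖ = 1)
    (hc : inner ℂ (ψ 0) (ψ 1) = (c : ℂ)) {N : POVM (Pair H)} (h : IsErrorFree ψ N)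
    (hs : IsSeparable N) (x y : ℝ) :
    x ^ 4 * prob N.fst (tvec (ψ 0) (ψ 0)) + y ^ 4 * prob N.fst (tvec (ψ 1) (ψ 1)) +
      x ^ 2 * y ^ 2 * (prob N.snd (tvec (ψ 0) (ψ 1)) + prob N.snd (tvec (ψ 1) (ψ 0))) ≤
      (x ^ 2 + y ^ 2 + 2 * c * x * y) ^ 2 := by
  have hb := N.prob_fst_add_prob_snd_le
    (tvec ((x : ℂ) • ψ 0 + (y : ℂ) • ψ 1) ((x : ℂ) • ψ 0 + (y : ℂ) • ψ 1))
  rw [norm_tvec, ← sq, ← pow_mul, pow_mul', norm_sq_combination hψ hc] at hb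
  have ha01 := apply_eq_zero_of_prob_eq_zero N.fst_pos (h.1 0 1 (by decide))
  have ha10 := apply_eq_zero_of_prob_eq_zero N.fst_pos (h.1 1 0 (by decide))
  have hb00 := apply_eq_zero_of_prob_eq_zero N.snd_pos (h.2 0)
  have hb11 := apply_eq_zero_of_prob_eq_zero N.snd_pos (h.2 1)
  have hA : inner ℂ (tvec (ψ 0) (ψ 0)) (N.fst (tvec (ψ 1) (ψ 1))) = (0 : ℂ) :=
    hs.1.inner_eq_zero (h.1 0 1 (by decide))
  have hB : inner ℂ (tvec (ψ 0) (ψ 1)) (N.snd (tvec (ψ 1) (ψ 0))) = (0 : ℂ) :=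
    hs.2.1.inner_eq_zero (h.2 0)
  rw [tvec_combination, prob_add_of_apply_eq_zero N.fst_pos _ (by simp [ha01, ha10]),
    add_comm (_ + _) (_ + _), prob_add_of_apply_eq_zero N.snd_pos _ (by simp [hb00, hb11]),
    prob_add_of_inner_eq_zero N.fst_pos (by simp [hA]),
    prob_add_of_inner_eq_zero N.snd_pos (by simp [hB])] at hb
  simp only [← Complex.ofReal_pow, ← Complex.ofReal_mul, prob_real_smul] at hb
  linarith

lemma IsErrorFree.rate_le_of_isSeparable [CompleteSpace H] (hψ : ∀ i, ‖ψ i‖ = 1)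
    (hc : inner ℂ (ψ 0) (ψ 1) = (c : ℂ)) (hc0 : 0 < c) (hq : ∀ i, 0 < q i)
    {N : POVM (Pair H)} (h : IsErrorFree ψ N) (hs : IsSeparable N) :
    rate ψ q N ≤ discriminationRate (q 0) (q 1) c ^ 2 := by
  obtain ⟨x, y, hx, hy, hxy⟩ := exists_dual (hq 0) (hq 1) hc0
  rw [← hxy, h.rate_eq]
  refine le_trans ?_ (h.prob_le_of_isSeparable hψ hc hs x y)
  have hq0 := (hq 0).le
  have hq1 := (hq 1).le
  have h0 : q 0 ^ 2 ≤ x ^ 4 := by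
    calc q 0 ^ 2 ≤ (x ^ 2) ^ 2 := pow_le_pow_left₀ hq0 hx 2
      _ = x ^ 4 := by ring
  have h1 : q 1 ^ 2 ≤ y ^ 4 := by
    calc q 1 ^ 2 ≤ (y ^ 2) ^ 2 := pow_le_pow_left₀ hq1 hy 2
      _ = y ^ 4 := by ring
  have h2 : q 0 * q 1 ≤ x ^ 2 * y ^ 2 := mul_le_mul hx hy hq1 (by positivity)
  refine add_le_add (add_le_add ?_ ?_) ?_
  · exact mul_le_mul_of_nonneg_right h0 (prob_nonneg N.fst_pos _)
  · exact mul_le_mul_of_nonneg_right h1 (prob_nonneg N.fst_pos _)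
  · exact mul_le_mul_of_nonneg_right h2
      (add_nonneg (prob_nonneg N.snd_pos _) (prob_nonneg N.snd_pos _))

end Comparison

/-! ### Coherent measurements -/

section Coherent

variable {H : Type*} [NormedAddCommGroup H] [InnerProductSpace ℂ H]
variable {ψ : Fin 2 → H} {q : Fin 2 → ℝ} {c : ℝ}

/-- The symmetric superposition `ψ₀ψ₁ + ψ₁ψ₀`. -/
noncomputable def symVec (ψ : Fin 2 → H) : Pair H := tvec (ψ 0) (ψ 1) + tvec (ψ 1) (ψ 0)

/-- The antisymmetric superposition `ψ₀ψ₁ - ψ₁ψ₀`. -/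
noncomputable def antiVec (ψ : Fin 2 → H) : Pair H := tvec (ψ 0) (ψ 1) - tvec (ψ 1) (ψ 0)

/-- The sum `ψ₀ψ₀ + ψ₁ψ₁`. -/
noncomputable def sumVec (ψ : Fin 2 → H) : Pair H := tvec (ψ 0) (ψ 0) + tvec (ψ 1) (ψ 1)

/-- The difference `ψ₀ψ₀ - ψ₁ψ₁`. -/
noncomputable def diffVec (ψ : Fin 2 → H) : Pair H := tvec (ψ 0) (ψ 0) - tvec (ψ 1) (ψ 1)

/-- A norm computed from a real value of the inner product. -/
lemma norm_sq_of_inner_self {E : Type*} [NormedAddCommGroup E] [InnerProductSpace ℂ E] {v : E}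
    {r : ℝ} (h : inner ℂ v v = (r : ℂ)) : ‖v‖ ^ 2 = r := by
  rw [← inner_self_eq_norm_sq (𝕜 := ℂ), h]
  exact Complex.ofReal_re _

lemma norm_symVec (hψ : ∀ i, ‖ψ i‖ = 1) (hc : inner ℂ (ψ 0) (ψ 1) = (c : ℂ)) :
    ‖symVec ψ‖ ^ 2 = 2 * (1 + c ^ 2) := by
  refine norm_sq_of_inner_self ?_
  simp only [symVec, inner_add_left, inner_add_right, inner_tvec, hc, inner_symm_real hc,
    inner_self_of_norm_eq_one (hψ _)]
  push_cast; ring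

lemma norm_sumVec (hψ : ∀ i, ‖ψ i‖ = 1) (hc : inner ℂ (ψ 0) (ψ 1) = (c : ℂ)) :
    ‖sumVec ψ‖ ^ 2 = 2 * (1 + c ^ 2) := by
  refine norm_sq_of_inner_self ?_
  simp only [sumVec, inner_add_left, inner_add_right, inner_tvec, hc, inner_symm_real hc,
    inner_self_of_norm_eq_one (hψ _)]
  push_cast; ring

lemma norm_antiVec (hψ : ∀ i, ‖ψ i‖ = 1) (hc : inner ℂ (ψ 0) (ψ 1) = (c : ℂ)) :
    ‖antiVec ψ‖ ^ 2 = 2 * (1 - c ^ 2) := by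
  refine norm_sq_of_inner_self ?_
  simp only [antiVec, inner_sub_left, inner_sub_right, inner_tvec, hc, inner_symm_real hc,
    inner_self_of_norm_eq_one (hψ _)]
  push_cast; ring

lemma norm_diffVec (hψ : ∀ i, ‖ψ i‖ = 1) (hc : inner ℂ (ψ 0) (ψ 1) = (c : ℂ)) :
    ‖diffVec ψ‖ ^ 2 = 2 * (1 - c ^ 2) := by
  refine norm_sq_of_inner_self ?_
  simp only [diffVec, inner_sub_left, inner_sub_right, inner_tvec, hc, inner_symm_real hc,
    inner_self_of_norm_eq_one (hψ _)]
  push_cast; ring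

lemma inner_sumVec_symVec (hψ : ∀ i, ‖ψ i‖ = 1) (hc : inner ℂ (ψ 0) (ψ 1) = (c : ℂ)) :
    inner ℂ (sumVec ψ) (symVec ψ) = ((4 * c : ℝ) : ℂ) := by
  simp only [sumVec, symVec, inner_add_left, inner_add_right, inner_tvec, hc, inner_symm_real hc,
    inner_self_of_norm_eq_one (hψ _)]
  push_cast; ring

lemma inner_sumVec_diffVec (hψ : ∀ i, ‖ψ i‖ = 1) (hc : inner ℂ (ψ 0) (ψ 1) = (c : ℂ)) :
    inner ℂ (sumVec ψ) (diffVec ψ) = (0 : ℂ) := by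
  simp only [sumVec, diffVec, inner_add_left, inner_sub_right, inner_tvec, hc, inner_symm_real hc,
    inner_self_of_norm_eq_one (hψ _)]
  ring

lemma inner_symVec_diffVec (hψ : ∀ i, ‖ψ i‖ = 1) (hc : inner ℂ (ψ 0) (ψ 1) = (c : ℂ)) :
    inner ℂ (symVec ψ) (diffVec ψ) = (0 : ℂ) := by
  simp only [symVec, diffVec, inner_add_left, inner_sub_right, inner_tvec, hc, inner_symm_real hc,
    inner_self_of_norm_eq_one (hψ _)]
  ring

lemma inner_sumVec_antiVec (hψ : ∀ i, ‖ψ i‖ = 1) (hc : inner ℂ (ψ 0) (ψ 1) = (c : ℂ)) :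
    inner ℂ (sumVec ψ) (antiVec ψ) = (0 : ℂ) := by
  simp only [sumVec, antiVec, inner_add_left, inner_sub_right, inner_tvec, hc, inner_symm_real hc,
    inner_self_of_norm_eq_one (hψ _)]
  ring

lemma inner_symVec_antiVec (hψ : ∀ i, ‖ψ i‖ = 1) (hc : inner ℂ (ψ 0) (ψ 1) = (c : ℂ)) :
    inner ℂ (symVec ψ) (antiVec ψ) = (0 : ℂ) := by
  simp only [symVec, antiVec, inner_add_left, inner_sub_right, inner_tvec, hc, inner_symm_real hc,
    inner_self_of_norm_eq_one (hψ _)]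
  ring

lemma inner_antiVec_diffVec (hψ : ∀ i, ‖ψ i‖ = 1) (hc : inner ℂ (ψ 0) (ψ 1) = (c : ℂ)) :
    inner ℂ (antiVec ψ) (diffVec ψ) = (0 : ℂ) := by
  simp only [antiVec, diffVec, inner_sub_left, inner_sub_right, inner_tvec, hc, inner_symm_real hc,
    inner_self_of_norm_eq_one (hψ _)]
  ring

lemma inner_tvec_self_symVec (hψ : ∀ i, ‖ψ i‖ = 1) (hc : inner ℂ (ψ 0) (ψ 1) = (c : ℂ))
    (i : Fin 2) : inner ℂ (tvec (ψ i) (ψ i)) (symVec ψ) = ((2 * c : ℝ) : ℂ) := by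
  fin_cases i <;>
  · simp [symVec, inner_add_right, inner_tvec, hc, inner_symm_real hc, hψ]
    ring

/-- The parallelogram identity for expectations. -/
lemma prob_add_prob {E : Type*} [NormedAddCommGroup E] [InnerProductSpace ℂ E] (F : E →L[ℂ] E)
    (u v : E) : prob F u + prob F v = (prob F (u + v) + prob F (u - v)) / 2 := by
  simp only [prob, map_add, map_sub, inner_add_left, inner_add_right, inner_sub_left,
    inner_sub_right, Complex.add_re, Complex.sub_re]
  ring

/-- The trade-off between the detection of equal states and that of `ψ₀ψ₁ + ψ₁ψ₀`. -/
lemma IsErrorFree.prob_le [CompleteSpace H] (hψ : ∀ i, ‖ψ i‖ = 1)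
    (hc : inner ℂ (ψ 0) (ψ 1) = (c : ℂ)) {N : POVM (Pair H)} (h : IsErrorFree ψ N) (i : Fin 2)
    (x y : ℝ) :
    x ^ 2 * prob N.fst (tvec (ψ i) (ψ i)) + y ^ 2 * prob N.snd (symVec ψ) ≤
      x ^ 2 + 4 * c * x * y + 2 * (1 + c ^ 2) * y ^ 2 := by
  have hb := N.prob_fst_add_prob_snd_le ((x : ℂ) • tvec (ψ i) (ψ i) + (y : ℂ) • symVec ψ)
  have ha01 := apply_eq_zero_of_prob_eq_zero N.fst_pos (h.1 0 1 (by decide))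
  have ha10 := apply_eq_zero_of_prob_eq_zero N.fst_pos (h.1 1 0 (by decide))
  have hbii := apply_eq_zero_of_prob_eq_zero N.snd_pos (h.2 i)
  rw [norm_sq_real_combination (a := 1) (by simp [norm_tvec, hψ]) (norm_symVec hψ hc)
    (inner_tvec_self_symVec hψ hc i),
    prob_add_of_apply_eq_zero N.fst_pos _ (by
      rw [map_smul, symVec, map_add, ha01, ha10, add_zero, smul_zero]),
    add_comm (_ • _) (_ • _), prob_add_of_apply_eq_zero N.snd_pos _ (by
      rw [map_smul, hbii, smul_zero]),
    prob_real_smul, prob_real_smul] at hb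
  linarith

lemma IsErrorFree.rate_le [CompleteSpace H] (hψ : ∀ i, ‖ψ i‖ = 1)
    (hc : inner ℂ (ψ 0) (ψ 1) = (c : ℂ)) (hc0 : 0 < c) (hq : ∀ i, 0 < q i)
    (hqs : q 0 + q 1 = 1) {N : POVM (Pair H)} (h : IsErrorFree ψ N) :
    rate ψ q N ≤ (1 - c ^ 2 +
      (1 + c ^ 2) * discriminationRate (etaA q) (etaB q) (pairOverlap c)) / 2 := by
  obtain ⟨x, y, hx, hy, hxy⟩ := exists_dual_of_le (etaB_pos (hq 0) (hq 1)) (etaB_le_etaA q)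
    (pairOverlap_pos hc0)
  have hS := prob_nonneg N.snd_pos (symVec ψ)
  have hA : prob N.snd (antiVec ψ) ≤ 2 * (1 - c ^ 2) := by
    rw [← norm_antiVec hψ hc]; exact N.prob_snd_le _
  have hSA := prob_add_prob N.snd (tvec (ψ 0) (ψ 1)) (tvec (ψ 1) (ψ 0))
  -- These two bounds are averaged with the weights `qᵢ²`, whose sum is `η_a = x²`. The coefficient
  -- `y / 2` provides `ψ₀ψ₁ + ψ₁ψ₀` with the weight `y² / 4 ≥ η_b / 4` that it has in the rate.
  have h0 := h.prob_le hψ hc 0 x (y / 2)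
  have h1 := h.prob_le hψ hc 1 x (y / 2)
  rw [hx] at h0 h1
  have hηA := etaA_pos (hq 0)
  have hηB := etaB_pos (hq 0) (hq 1)
  have hκ := one_add_sq_mul_pairOverlap c
  have hsum := etaA_add_etaB hqs
  rw [← hxy, h.rate_eq, hSA]
  change _ + _ * ((prob N.snd (symVec ψ) + prob N.snd (antiVec ψ)) / 2) ≤ _
  set S := prob N.snd (symVec ψ)
  set A := prob N.snd (antiVec ψ)
  set a := prob N.fst (tvec (ψ 0) (ψ 0))
  set b := prob N.fst (tvec (ψ 1) (ψ 1))
  have k1 : etaA q * (q 0 ^ 2 * a + q 1 ^ 2 * b + (y / 2) ^ 2 * S) ≤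
      etaA q * (etaA q + 4 * c * x * (y / 2) + 2 * (1 + c ^ 2) * (y / 2) ^ 2) := by
    have := add_le_add (mul_le_mul_of_nonneg_left h0 (sq_nonneg (q 0)))
      (mul_le_mul_of_nonneg_left h1 (sq_nonneg (q 1)))
    have e : etaA q = q 0 ^ 2 + q 1 ^ 2 := rfl
    generalize etaA q = η at *
    subst e
    linarith
  have k2 := le_of_mul_le_mul_left k1 hηA
  have k3 := mul_le_mul_of_nonneg_right hy hS
  have k4 := mul_le_mul_of_nonneg_left hA hηB.le
  have e : q 0 * q 1 = etaB q / 2 := by unfold etaB; ring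
  rw [e, hx]
  have hA1 : etaA q = 1 - etaB q := by linarith
  rw [hA1] at k2 ⊢
  have e2 : (1 + c ^ 2) * (1 - etaB q + y ^ 2 + 2 * pairOverlap c * x * y) =
    (1 + c ^ 2) * (1 - etaB q + y ^ 2) + 4 * c * x * y := by
    linear_combination 2 * x * y * hκ
  rw [e2]
  linarith

/-- Coherent comparison measurements. On the span of `ψ₀ψ₀ + ψ₁ψ₁` and `ψ₀ψ₁ + ψ₁ψ₀` they
discriminate these two vectors; the orthogonal vectors `ψ₀ψ₀ - ψ₁ψ₁` and `ψ₀ψ₁ - ψ₁ψ₀` are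
detected with certainty. -/
lemma exists_isComparison (hψ : ∀ i, ‖ψ i‖ = 1)
    (hc : inner ℂ (ψ 0) (ψ 1) = (c : ℂ)) (hc0 : 0 < c) (hc1 : c < 1) (hq : ∀ i, 0 < q i)
    (hqs : q 0 + q 1 = 1) {p r : ℝ} (h : IsFeasible (pairOverlap c) p r) :
    ∃ N : POVM (Pair H), IsComparison ψ q N ∧
      rate ψ q N = (1 - c ^ 2 + (1 + c ^ 2) * (etaA q * p + etaB q * r)) / 2 := by
  obtain ⟨hp0, hp1, hr0, hr1, hpr⟩ := h
  have hm : 0 < 1 - c ^ 2 := by nlinarith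
  set n := √(2 * (1 + c ^ 2)) with hn
  set d := √(2 * (1 - c ^ 2)) with hd
  have hn0 : 0 < n := Real.sqrt_pos.mpr (by positivity)
  have hd0 : 0 < d := Real.sqrt_pos.mpr (by positivity)
  have hn2 : n ^ 2 = 2 * (1 + c ^ 2) := Real.sq_sqrt (by positivity)
  have hd2 : d ^ 2 = 2 * (1 - c ^ 2) := Real.sq_sqrt (by positivity)
  have norm_eq : ∀ {v : Pair H} {t s : ℝ}, 0 < t → t ^ 2 = s → ‖v‖ ^ 2 = s →
      ‖((t⁻¹ : ℝ) : ℂ) • v‖ = 1 := by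
    intro v t s ht hts hv
    have : ‖v‖ = t := by
      rw [← hts] at hv
      exact (pow_left_inj₀ (norm_nonneg _) ht.le two_ne_zero).mp hv
    rw [norm_smul, this, Complex.norm_real, norm_inv, Real.norm_of_nonneg ht.le,
      inv_mul_cancel₀ ht.ne']
  have nT := norm_eq hn0 hn2 (norm_sumVec hψ hc)
  have nS := norm_eq hn0 hn2 (norm_symVec hψ hc)
  have nD := norm_eq hd0 hd2 (norm_diffVec hψ hc)
  have nA := norm_eq hd0 hd2 (norm_antiVec hψ hc)
  have hTS : inner ℂ (((n⁻¹ : ℝ) : ℂ) • sumVec ψ) (((n⁻¹ : ℝ) : ℂ) • symVec ψ) =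
      ((pairOverlap c : ℝ) : ℂ) := by
    rw [inner_smul_left, inner_smul_right, inner_sumVec_symVec hψ hc, Complex.conj_ofReal,
      ← Complex.ofReal_mul, ← Complex.ofReal_mul]
    congr 1
    rw [pairOverlap, ← mul_assoc, ← mul_inv, ← sq, hn2]
    field_simp
    ring
  obtain ⟨N, hN⟩ := exists_povm_discrimination nT nS hTS (pairOverlap_pos hc0)
    (pairOverlap_lt_one hc1) hp0 hp1 hr0 hr1 hpr nD.le nA.le
    (by rw [inner_smul_left, inner_smul_right, inner_sumVec_diffVec hψ hc, mul_zero, mul_zero])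
    (by rw [inner_smul_left, inner_smul_right, inner_symVec_diffVec hψ hc, mul_zero, mul_zero])
    (by rw [inner_smul_left, inner_smul_right, inner_sumVec_antiVec hψ hc, mul_zero, mul_zero])
    (by rw [inner_smul_left, inner_smul_right, inner_symVec_antiVec hψ hc, mul_zero, mul_zero])
    (by rw [inner_smul_left, inner_smul_right, inner_antiVec_diffVec hψ hc, mul_zero, mul_zero])
  have e00 : tvec (ψ 0) (ψ 0) = ((n / 2 : ℝ) : ℂ) • (((n⁻¹ : ℝ) : ℂ) • sumVec ψ) +
      (0 : ℂ) • (((n⁻¹ : ℝ) : ℂ) • symVec ψ) + ((d / 2 : ℝ) : ℂ) • (((d⁻¹ : ℝ) : ℂ) • diffVec ψ) +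
      (0 : ℂ) • (((d⁻¹ : ℝ) : ℂ) • antiVec ψ) := by
    simp only [smul_smul, ← Complex.ofReal_mul, div_mul_eq_mul_div, mul_inv_cancel₀ hn0.ne',
      mul_inv_cancel₀ hd0.ne', sumVec, diffVec]
    push_cast
    module
  have e11 : tvec (ψ 1) (ψ 1) = ((n / 2 : ℝ) : ℂ) • (((n⁻¹ : ℝ) : ℂ) • sumVec ψ) +
      (0 : ℂ) • (((n⁻¹ : ℝ) : ℂ) • symVec ψ) +
      ((-d / 2 : ℝ) : ℂ) • (((d⁻¹ : ℝ) : ℂ) • diffVec ψ) +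
      (0 : ℂ) • (((d⁻¹ : ℝ) : ℂ) • antiVec ψ) := by
    simp only [smul_smul, ← Complex.ofReal_mul, div_mul_eq_mul_div, neg_mul,
      mul_inv_cancel₀ hn0.ne', mul_inv_cancel₀ hd0.ne', sumVec, diffVec]
    push_cast
    module
  have e01 : tvec (ψ 0) (ψ 1) = (0 : ℂ) • (((n⁻¹ : ℝ) : ℂ) • sumVec ψ) +
      ((n / 2 : ℝ) : ℂ) • (((n⁻¹ : ℝ) : ℂ) • symVec ψ) + (0 : ℂ) • (((d⁻¹ : ℝ) : ℂ) • diffVec ψ) +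
      ((d / 2 : ℝ) : ℂ) • (((d⁻¹ : ℝ) : ℂ) • antiVec ψ) := by
    simp only [smul_smul, ← Complex.ofReal_mul, div_mul_eq_mul_div, mul_inv_cancel₀ hn0.ne',
      mul_inv_cancel₀ hd0.ne', symVec, antiVec]
    push_cast
    module
  have e10 : tvec (ψ 1) (ψ 0) = (0 : ℂ) • (((n⁻¹ : ℝ) : ℂ) • sumVec ψ) +
      ((n / 2 : ℝ) : ℂ) • (((n⁻¹ : ℝ) : ℂ) • symVec ψ) + (0 : ℂ) • (((d⁻¹ : ℝ) : ℂ) • diffVec ψ) +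
      ((-d / 2 : ℝ) : ℂ) • (((d⁻¹ : ℝ) : ℂ) • antiVec ψ) := by
    simp only [smul_smul, ← Complex.ofReal_mul, div_mul_eq_mul_div, neg_mul,
      mul_inv_cancel₀ hn0.ne', mul_inv_cancel₀ hd0.ne', symVec, antiVec]
    push_cast
    module
  have m00 := hN ((n / 2 : ℝ) : ℂ) 0 ((d / 2 : ℝ) : ℂ) 0
  have m11 := hN ((n / 2 : ℝ) : ℂ) 0 ((-d / 2 : ℝ) : ℂ) 0
  have m01 := hN 0 ((n / 2 : ℝ) : ℂ) 0 ((d / 2 : ℝ) : ℂ)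
  have m10 := hN 0 ((n / 2 : ℝ) : ℂ) 0 ((-d / 2 : ℝ) : ℂ)
  rw [← e00] at m00
  rw [← e11] at m11
  rw [← e01] at m01
  rw [← e10] at m10
  have hn4 : (n / 2) ^ 2 = (1 + c ^ 2) / 2 := by rw [div_pow, hn2]; ring
  have hd4 : (d / 2) ^ 2 = (1 - c ^ 2) / 2 := by rw [div_pow, hd2]; ring
  have hd4' : (-d / 2) ^ 2 = (1 - c ^ 2) / 2 := by rw [div_pow, neg_sq, hd2]; ring
  simp only [Complex.norm_real, Real.norm_eq_abs, sq_abs, hn4, hd4, hd4', nD, nA, norm_zero,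
    one_pow, mul_one, ne_eq, OfNat.ofNat_ne_zero, not_false_eq_true, zero_pow, mul_zero, add_zero]
    at m00 m11 m01 m10
  have hq0 := hq 0
  have hq1 := hq 1
  refine ⟨N, ⟨fun i j => ?_, fun i j => ?_⟩, ?_⟩
  · fin_cases i <;> fin_cases j <;> simp [m00, m01, m10, m11] <;> positivity
  · fin_cases i <;> fin_cases j <;> simp [m00, m01, m10, m11] <;> positivity
  · simp only [rate, Fin.sum_univ_two, prob_add_left, m00, m01, m10, m11, etaA, etaB]
    linear_combination (1 - c ^ 2) / 2 * (q 0 + q 1 + 1) * hqs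

end Coherent

/-! ### Attainability and comparison of the two optima -/

section Main

variable {H : Type*} [NormedAddCommGroup H] [InnerProductSpace ℂ H]
variable {ψ : Fin 2 → H} {q : Fin 2 → ℝ} {c : ℝ}

/-- Separable unambiguous comparison measurements come arbitrarily close to the separable optimum:
local discriminations with both detection probabilities positive approximate the optimal one. -/
lemma discriminationRate_sq_le_of_mem_upperBounds [CompleteSpace H] (hψ : ∀ i, ‖ψ i‖ = 1)
    (hc : inner ℂ (ψ 0) (ψ 1) = (c : ℂ)) (hc0 : 0 < c) (hc1 : c < 1) (hq : ∀ i, 0 < q i) {b : ℝ}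
    (hb : b ∈ upperBounds {P : ℝ | ∃ N : POVM (Pair H),
      IsSeparable N ∧ IsComparison ψ q N ∧ rate ψ q N = P}) :
    discriminationRate (q 0) (q 1) c ^ 2 ≤ b := by
  obtain ⟨p, r, hpr, he⟩ := exists_isFeasible (hq 0) (hq 1) hc0 hc1
  set f : ℝ → ℝ := fun t => (q 0 * ((1 - t) * p + t * (1 - c)) +
    q 1 * ((1 - t) * r + t * (1 - c))) ^ 2 with hf
  have hlim : Tendsto f (𝓝[>] 0) (𝓝 (discriminationRate (q 0) (q 1) c ^ 2)) := by
    have hcont : Continuous f := by fun_prop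
    have h0 : f 0 = discriminationRate (q 0) (q 1) c ^ 2 := by rw [← he, hf]; ring
    rw [← h0]
    exact hcont.continuousAt.tendsto.mono_left nhdsWithin_le_nhds
  refine le_of_tendsto hlim ?_
  filter_upwards [Ioo_mem_nhdsGT (zero_lt_one' ℝ)] with t ht
  have hpos : ∀ {x : ℝ}, 0 ≤ x → 0 < (1 - t) * x + t * (1 - c) := fun hx =>
    add_pos_of_nonneg_of_pos (mul_nonneg (by linarith [ht.2]) hx)
      (mul_pos ht.1 (by linarith))
  obtain ⟨M, hM, h0, h1⟩ := exists_isUD hψ hc hc0 hc1 (hpr.mix hc0 hc1 ht.1.le ht.2.le)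
  obtain ⟨N, hN, hsep⟩ := exists_isLocalDiscrimination M
  refine hb ⟨N, hsep, hM.isComparison hq hN ?_ ?_, ?_⟩
  · rw [h0]; exact hpos hpr.1
  · rw [h1]; exact hpos hpr.2.2.1
  · rw [hM.rate_eq hN, udRate, h0, h1]

/-- The coherent optimum exceeds the separable one, because a suitable coherent measurement does.
If the local optimum uses both outcomes, this is the measurement with detection probabilities
`1 - κ τ` and `1 - κ / τ` for `τ = 2 √(q₀ q₁)`; otherwise it is the one that never detects
`ψ₀ψ₁ + ψ₁ψ₀`. -/
lemma exists_isFeasible_discriminationRate_sq_lt (hq : ∀ i, 0 < q i) (hqs : q 0 + q 1 = 1)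
    (hc0 : 0 < c) (hc1 : c < 1) :
    ∃ p r, IsFeasible (pairOverlap c) p r ∧ discriminationRate (q 0) (q 1) c ^ 2 <
      (1 - c ^ 2 + (1 + c ^ 2) * (etaA q * p + etaB q * r)) / 2 := by
  have hq0 := hq 0
  have hq1 := hq 1
  have hκ := one_add_sq_mul_pairOverlap c
  have hκ0 := pairOverlap_pos hc0
  have hκ1 := pairOverlap_lt_one hc1
  have hmm : max (q 0) (q 1) * min (q 0) (q 1) = q 0 * q 1 := by
    rw [mul_comm, min_mul_max]
  have hms : max (q 0) (q 1) + min (q 0) (q 1) = 1 := by rw [max_add_min, hqs]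
  have hm0 : 0 < min (q 0) (q 1) := lt_min hq0 hq1
  have hM0 : min (q 0) (q 1) ≤ max (q 0) (q 1) := min_le_max
  set Q := max (q 0) (q 1) with hQ
  set m := min (q 0) (q 1) with hm
  have hm1 : m = 1 - Q := by linarith
  have hB : etaB q = 2 * (Q * m) := by rw [hmm, etaB]; ring
  have hA : etaA q = 1 - 2 * (Q * m) := by rw [← hB]; linarith [etaA_add_etaB hqs]
  rw [hA, hB]
  by_cases hcond : c < √(m / Q)
  · set g := √(q 0 * q 1) with hg
    have hg0 : 0 < g := Real.sqrt_pos.mpr (by positivity)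
    have hg2 : g ^ 2 = Q * m := by rw [hg, Real.sq_sqrt (by positivity), hmm]
    have hg1 : g ≤ 1 / 2 := by
      refine (sq_le_sq₀ hg0.le (by norm_num)).mp ?_
      rw [hg2, hm1]; nlinarith [sq_nonneg (2 * Q - 1)]
    have hκg : pairOverlap c ≤ 2 * g := by
      rw [Real.lt_sqrt hc0.le, lt_div_iff₀ (by linarith)] at hcond
      have h1 : c / (1 + c ^ 2) ≤ g := by
        refine (sq_le_sq₀ (by positivity) hg0.le).mp ?_
        rw [hg2, div_pow, div_le_iff₀ (by positivity), hm1]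
        -- The difference of the two sides is `((1 + c²) Q - c²) (1 - (1 + c²) Q)`.
        have h2 : 0 ≤ 1 - (1 + c ^ 2) * Q := by linarith
        have h3 : 0 ≤ (1 + c ^ 2) * Q - c ^ 2 := by nlinarith
        nlinarith [mul_nonneg h2 h3]
      rw [pairOverlap, mul_div_assoc]
      linarith
    refine ⟨1 - pairOverlap c * (2 * g), 1 - pairOverlap c / (2 * g), ⟨?_, ?_, ?_, ?_, ?_⟩, ?_⟩
    · nlinarith
    · have : 0 ≤ pairOverlap c * (2 * g) := by positivity
      linarith
    · have : pairOverlap c / (2 * g) ≤ 1 := (div_le_one (by positivity)).mpr hκg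
      linarith
    · have : 0 ≤ pairOverlap c / (2 * g) := by positivity
      linarith
    · refine le_of_eq ?_
      field_simp
      ring
    · rw [discriminationRate, if_pos hcond, hqs, ← hg, ← hg2]
      have e : (1 - c ^ 2 + (1 + c ^ 2) * ((1 - 2 * g ^ 2) * (1 - pairOverlap c * (2 * g)) +
          2 * g ^ 2 * (1 - pairOverlap c / (2 * g)))) / 2 = 1 - c * g * (3 - 4 * g ^ 2) := by
        have e1 : 2 * g ^ 2 * (1 - pairOverlap c / (2 * g)) = 2 * g ^ 2 - pairOverlap c * g := by
          field_simp
        rw [e1]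
        linear_combination (-(g * (3 - 4 * g ^ 2)) / 2) * hκ
      rw [e]
      have h4 : 4 * g * c < 1 + 4 * g ^ 2 := by nlinarith [sq_nonneg (1 - 2 * g)]
      nlinarith [mul_lt_mul_of_pos_left h4 (mul_pos hc0 hg0)]
  · refine ⟨1 - pairOverlap c ^ 2, 0, ⟨by nlinarith, by nlinarith, le_rfl, zero_le_one,
      by linarith⟩, ?_⟩
    rw [discriminationRate, if_neg hcond, ← hQ, hm1]
    have hQ1 : Q < 1 := by linarith
    have hQ0 : 0 < Q := by linarith
    have hs : 0 < 1 - c ^ 2 := by nlinarith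
    have e : (1 - c ^ 2 + (1 + c ^ 2) *
        ((1 - 2 * (Q * (1 - Q))) * (1 - pairOverlap c ^ 2) + 2 * (Q * (1 - Q)) * 0)) / 2 =
        (1 - c ^ 2) * (1 - Q * (1 - Q) * (1 - c ^ 2)) / (1 + c ^ 2) := by
      rw [pairOverlap]
      field_simp
      ring
    rw [e, lt_div_iff₀ (by positivity)]
    have h5 : (1 - c ^ 2) * (Q * (1 + Q * c ^ 2)) < 1 := by
      have h6 : Q * (1 + Q * c ^ 2) ≤ 1 + c ^ 2 := by
        have : Q * Q ≤ 1 := by nlinarith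
        nlinarith [mul_le_mul_of_nonneg_right this (sq_nonneg c)]
      have h7 : 0 < c ^ 4 := by positivity
      nlinarith [mul_le_mul_of_nonneg_left h6 hs.le]
    nlinarith [mul_lt_mul_of_pos_left h5 hs]

end Main

end StateComparison

open StateComparison in
theorem mainTheorem3 {H : Type*} [NormedAddCommGroup H] [InnerProductSpace ℂ H] [CompleteSpace H]
    (ψ : Fin 2 → H) (hψ : ∀ i, ‖ψ i‖ = 1)
    (q : Fin 2 → ℝ) (hq : ∀ i, 0 < q i) (hq_sum : q 0 + q 1 = 1)
    (θ : ℝ) (hθ : ‖(inner ℂ (ψ 0) (ψ 1) : ℂ)‖ = Real.cos θ)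
    (hθ_pos : 0 < Real.cos θ) (hθ_lt : Real.cos θ < 1) :
    (∃ M : StateComparison.POVM H, StateComparison.IsOptimalUD ψ q M) ∧
    (∀ M : StateComparison.POVM H, StateComparison.IsOptimalUD ψ q M →
      ∃ N : StateComparison.POVM (StateComparison.Pair H),
        StateComparison.IsLocalDiscrimination M N ∧
        StateComparison.IsSeparable N ∧
        StateComparison.IsErrorFree ψ N ∧
        (StateComparison.SepCondition q θ → StateComparison.IsComparison ψ q N) ∧
        StateComparison.rate ψ q N = StateComparison.udRate ψ q M ^ 2 ∧
        StateComparison.rate ψ q N = StateComparison.Psep q θ) ∧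
    IsGreatest {P : ℝ | ∃ N : StateComparison.POVM (StateComparison.Pair H),
        StateComparison.IsSeparable N ∧ StateComparison.IsErrorFree ψ N ∧
        StateComparison.rate ψ q N = P} (StateComparison.Psep q θ) ∧
    IsLUB {P : ℝ | ∃ N : StateComparison.POVM (StateComparison.Pair H),
        StateComparison.IsSeparable N ∧ StateComparison.IsComparison ψ q N ∧
        StateComparison.rate ψ q N = P} (StateComparison.Psep q θ) ∧
    IsGreatest {P : ℝ | ∃ N : StateComparison.POVM (StateComparison.Pair H),
        StateComparison.IsComparison ψ q N ∧
        StateComparison.rate ψ q N = P} (StateComparison.Popt q θ) ∧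
    StateComparison.Psep q θ < StateComparison.Popt q θ := by
  -- All notions depend on the two vectors only up to phases, so their overlap may be taken real.
  obtain ⟨ω, hω, hc⟩ := exists_phases ψ
  rw [hθ] at hc
  set φ : Fin 2 → H := fun i => ω i • ψ i with hφ
  have hn : ∀ i, ‖φ i‖ = 1 := fun i => by rw [hφ, norm_smul, hω, hψ, one_mul]
  have hc : inner ℂ (φ 0) (φ 1) = (Real.cos θ : ℂ) := hc
  rw [← isOptimalUD_phase hω, ← isErrorFree_phase hω, ← isComparison_phase hω, ← rate_phase hω,
    ← udRate_phase hω, ← hφ, psep_eq hq_sum, popt_eq (hq 0) (hq 1) hq_sum hθ_lt,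
    sepCondition_iff hq_sum]
  set c := Real.cos θ
  have hlocal : ∀ M : POVM H, IsOptimalUD φ q M → ∃ N : POVM (Pair H),
      IsLocalDiscrimination M N ∧ IsSeparable N ∧ IsErrorFree φ N ∧
      (c < √(min (q 0) (q 1) / max (q 0) (q 1)) → IsComparison φ q N) ∧
      rate φ q N = udRate φ q M ^ 2 ∧ rate φ q N = discriminationRate (q 0) (q 1) c ^ 2 := by
    intro M hM
    obtain ⟨N, hN, hsep⟩ := exists_isLocalDiscrimination M
    refine ⟨N, hN, hsep, hM.1.isErrorFree hN, fun hcond => ?_, hM.1.rate_eq hN, ?_⟩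
    · obtain ⟨h0, h1⟩ := hM.prob_pos hn hc hθ_pos hθ_lt hq hcond
      exact hM.1.isComparison hq hN h0 h1
    · rw [hM.1.rate_eq hN, hM.udRate_eq hn hc hθ_pos hθ_lt hq]
  have hopt := exists_isOptimalUD hn hc hθ_pos hθ_lt hq
  have hcoh : IsGreatest {P : ℝ | ∃ N : POVM (Pair H), IsComparison φ q N ∧ rate φ q N = P}
      ((1 - c ^ 2 + (1 + c ^ 2) *
        discriminationRate (etaA q) (etaB q) (pairOverlap c)) / 2) := by
    constructor
    · obtain ⟨p, r, hpr, he⟩ := exists_isFeasible (etaA_pos (hq 0)) (etaB_pos (hq 0) (hq 1))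
        (pairOverlap_pos hθ_pos) (pairOverlap_lt_one hθ_lt)
      rw [← he]
      exact exists_isComparison hn hc hθ_pos hθ_lt hq hq_sum hpr
    · rintro P ⟨N, hN, rfl⟩
      exact (hN.isErrorFree hq).rate_le hn hc hθ_pos hq hq_sum
  refine ⟨hopt, hlocal, ⟨?_, ?_⟩, ⟨?_, ?_⟩, hcoh, ?_⟩
  · obtain ⟨M, hM⟩ := hopt
    obtain ⟨N, -, hsep, hN, -, -, hr⟩ := hlocal M hM
    exact ⟨N, hsep, hN, hr⟩
  · rintro P ⟨N, hsep, hN, rfl⟩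
    exact hN.rate_le_of_isSeparable hn hc hθ_pos hq hsep
  · rintro P ⟨N, hsep, hN, rfl⟩
    exact (hN.isErrorFree hq).rate_le_of_isSeparable hn hc hθ_pos hq hsep
  · exact fun b hb => discriminationRate_sq_le_of_mem_upperBounds hn hc hθ_pos hθ_lt hq hb
  · obtain ⟨p, r, hpr, hlt⟩ :=
      exists_isFeasible_discriminationRate_sq_lt hq hq_sum hθ_pos hθ_lt
    exact hlt.trans_le (hcoh.2 (exists_isComparison hn hc hθ_pos hθ_lt hq hq_sum hpr))
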